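/- Let $R$ be a commutative noetherian ring, let $t\in R$, and assume that $R$ is $tR$-adically complete. Let $A$ be a (nonnegatively graded, graded commutative) DG $R$-algebra such that each $A_i$ is a free $R$-module of finite rank, let $K^R(t)=(0\to R\xrightarrow{t}R\to 0)$ be the Koszul complex, and let $B=K^R(t)\otimes_R A$, a DG $R$-algebra with the morphism $A\to B$, $a\mapsto 1\otimes a$. Complexes are graded homologically. A DG module $M$ is homologically bounded below if $\operatorname{H}_i(M)=0$ for $i\ll 0$, and homologically degreewise finite (over $A$) if each $\operatorname{H}_i(M)$ is finitely generated over $\operatorname{H}_0(A)$, and similarly over $B$. A DG $A$-module is semi-free if it is bounded below and its underlying graded $A^\natural$-module has a basis of homogeneous elements; $\operatorname{Ext}^i_A(M,N)=\operatorname{H}_{-i}(\operatorname{Hom}_A(F,N))$ for a semi-free resolution $F\xrightarrow{\simeq}M$; similarly over $B$. A quasi-lifting of a DG $B$-module $D$ to $A$ is a semi-free DG $A$-module $M$ such that $D$ and $B\otimes_A M$ are connected by a finite zigzag of quasiisomorphisms of DG $B$-modules. Let $D$ be a DG $B$-module that is homologically bounded below and homologically degreewise finite, and suppose that $\operatorname{Ext}^d_B(D,D)=0$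 for some integer $d$. If $M$ is a homologically degreewise finite quasi-lifting of $D$ to $A$, then $\operatorname{Ext}^d_A(M,M)=0$. -/

import Mathlib

open scoped DirectSum TensorProduct

universe u

noncomputable section

namespace DG

section Grading

variable {R M N P : Type*} [CommRing R] [AddCommGroup M] [Module R M] [AddCommGroup N] [Module R N]
  [AddCommGroup P] [Module R P]

theorem map_units_smul (f : M →ₗ[R] N) (u : ℤˣ) (m : M) : f (u • m) = u • f m := by
  rcases Int.units_eq_one_or u with rfl | rfl <;> simp

theorem map_units_smul₂ (f : M →ₗ[R] N →ₗ[R] P) (u : ℤˣ) (m : M) (n : N) :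
    f (u • m) n = u • f m n := by
  rcases Int.units_eq_one_or u with rfl | rfl <;> simp

theorem mul_units_smul {S : Type*} [Ring S] (u : ℤˣ) (a b : S) : a * (u • b) = u • (a * b) := by
  rcases Int.units_eq_one_or u with rfl | rfl <;> simp

theorem units_smul_mul {S : Type*} [Ring S] (u : ℤˣ) (a b : S) : (u • a) * b = u • (a * b) := by
  rcases Int.units_eq_one_or u with rfl | rfl <;> simp

/-- The sign involution `m ↦ (-1)^{|m|} m` of a graded module. -/
def signMap (gr : ℤ → Submodule R M) [DirectSum.Decomposition gr] : M →ₗ[R] M :=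
  DirectSum.toModule R ℤ M (fun i => (i.negOnePow : ℤ) • (gr i).subtype) ∘ₗ
    (DirectSum.decomposeLinearEquiv gr).toLinearMap

theorem signMap_apply (gr : ℤ → Submodule R M) [DirectSum.Decomposition gr] {i : ℤ} {m : M}
    (hm : m ∈ gr i) : signMap gr m = i.negOnePow • m := by
  lift m to gr i using hm
  simp [signMap, Units.smul_def]

/-- Given `β : M × N → P` bilinear, the submodule of `P` spanned by all `β m n`
with `m`, `n` homogeneous and `|m| + |n| = k`. -/
def totalGr (gM : ℤ → Submodule R M) (gN : ℤ → Submodule R N) (β : M →ₗ[R] N →ₗ[R] P) (k : ℤ) :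
    Submodule R P :=
  Submodule.span R {x | ∃ i j m n, m ∈ gM i ∧ n ∈ gN j ∧ i + j = k ∧ x = β m n}

theorem mem_totalGr {gM : ℤ → Submodule R M} {gN : ℤ → Submodule R N} {β : M →ₗ[R] N →ₗ[R] P}
    {i j k : ℤ} {m : M} {n : N} (hm : m ∈ gM i) (hn : n ∈ gN j) (h : i + j = k) :
    β m n ∈ totalGr gM gN β k :=
  Submodule.subset_span ⟨i, j, m, n, hm, hn, h, rfl⟩

/-- The bilinear map into the direct sum sending homogeneous `m`, `n` to `β m n` placed
in degree `|m| + |n|`. -/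
def totalDec (gM : ℤ → Submodule R M) (gN : ℤ → Submodule R N) (β : M →ₗ[R] N →ₗ[R] P)
    [DirectSum.Decomposition gM] [DirectSum.Decomposition gN] :
    M →ₗ[R] N →ₗ[R] ⨁ k, totalGr gM gN β k :=
  ((DirectSum.toModule R ℤ _ (fun i =>
    (DirectSum.toModule R ℤ _ (fun j =>
      (LinearMap.mk₂ R (fun (m : gM i) (n : gN j) =>
        DirectSum.lof R ℤ (fun k => totalGr gM gN β k) (i + j)
          ⟨β m n, mem_totalGr m.2 n.2 rfl⟩)
        (by intro a b c; rw [← map_add]; congr 1; ext; simp)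
        (by intro a b c; rw [← map_smul]; congr 1; ext; simp)
        (by intro a b c; rw [← map_add]; congr 1; ext; simp)
        (by intro a b c; rw [← map_smul]; congr 1; ext; simp)).flip)).flip)).compl₁₂
    (DirectSum.decomposeLinearEquiv gM).toLinearMap
    (DirectSum.decomposeLinearEquiv gN).toLinearMap)

theorem totalDec_apply (gM : ℤ → Submodule R M) (gN : ℤ → Submodule R N)
    (β : M →ₗ[R] N →ₗ[R] P)
    [DirectSum.Decomposition gM] [DirectSum.Decomposition gN]
    {i j k : ℤ} {m : M} {n : N} (hm : m ∈ gM i) (hn : n ∈ gN j) (h : i + j = k) :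
    totalDec gM gN β m n =
      DirectSum.lof R ℤ (fun k => totalGr gM gN β k) k ⟨β m n, mem_totalGr hm hn h⟩ := by
  subst h
  lift m to gM i using hm
  lift n to gN j using hn
  simp [totalDec]

/-- The submodules `totalGr` decompose `P` as soon as the values of `β` span `P` and
the map `totalDec` factors through `P`. -/
abbrev totalDecomposition (gM : ℤ → Submodule R M) (gN : ℤ → Submodule R N)
    (β : M →ₗ[R] N →ₗ[R] P)
    [DirectSum.Decomposition gM] [DirectSum.Decomposition gN]
    (D : P →ₗ[R] ⨁ k, totalGr gM gN β k)
    (hD : ∀ m n, D (β m n) = totalDec gM gN β m n)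
    (hβ : ∀ p, p ∈ Submodule.span R {x | ∃ m n, x = β m n}) :
    DirectSum.Decomposition (totalGr gM gN β) :=
  DirectSum.Decomposition.ofLinearMap _ D
    (by
      have key : ∀ m n, (DirectSum.coeLinearMap (totalGr gM gN β)) (D (β m n)) = β m n := by
        intro m n
        induction m using DirectSum.Decomposition.inductionOn gM with
        | zero => simp
        | add m m' h h' => simp [h, h']
        | homogeneous m =>
          induction n using DirectSum.Decomposition.inductionOn gN with
          | zero => simp
          | add m m' h h' => simp [h, h']
          | homogeneous n =>
            rw [hD, totalDec_apply gM gN β m.2 n.2 rfl]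
            simp
      ext p
      induction hβ p using Submodule.span_induction with
      | mem x h => obtain ⟨m, n, rfl⟩ := h; exact key m n
      | zero => simp
      | add x y _ _ hx hy => rw [map_add, hx, hy, map_add]
      | smul a x _ hx => rw [map_smul, hx, map_smul])
    (by
      have key : ∀ k x (hx : x ∈ totalGr gM gN β k), D x = DirectSum.lof R ℤ _ k ⟨x, hx⟩ := by
        intro k x hx
        induction hx using Submodule.span_induction with
        | mem x h =>
          obtain ⟨i, j, m, n, hm, hn, h, rfl⟩ := h
          rw [hD, totalDec_apply gM gN β hm hn h]
        | zero => rw [map_zero]; symm; exact map_zero _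
        | add x y _ _ hx hy => rw [map_add, hx, hy, ← map_add]; rfl
        | smul a x _ hx => rw [map_smul, hx, ← map_smul]; rfl
      refine DirectSum.linearMap_ext R fun k => ?_
      ext1 x
      simp only [LinearMap.comp_apply, DirectSum.coeLinearMap_lof, LinearMap.id_apply]
      exact key k x x.2)

end Grading



end DG

/-- A commutative DG `R`-algebra: a graded `R`-algebra `⨁ i, gr i`, concentrated in nonnegative
degrees and graded commutative, with an `R`-linear differential of degree `-1` satisfying the
Leibniz rule. -/
structure DGAlgebra (R : Type u) [CommRing R] where
  carrier : Type u
  [ring : Ring carrier]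
  [algebra : Algebra R carrier]
  gr : ℤ → Submodule R carrier
  [graded : GradedAlgebra gr]
  gr_neg : ∀ i < 0, gr i = ⊥
  d : carrier →ₗ[R] carrier
  d_mem : ∀ {i a}, a ∈ gr i → d a ∈ gr (i - 1)
  d_d : ∀ a, d (d a) = 0
  leibniz : ∀ {i a}, a ∈ gr i → ∀ b, d (a * b) = d a * b + i.negOnePow • (a * d b)
  comm : ∀ {i j a b}, a ∈ gr i → b ∈ gr j → a * b = (i * j).negOnePow • (b * a)
  sq_zero : ∀ {i a}, Odd i → a ∈ gr i → a * a = 0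

namespace DGAlgebra

variable {R : Type u} [CommRing R]

instance : CoeSort (DGAlgebra R) (Type u) := ⟨carrier⟩

instance (A : DGAlgebra R) : Ring A := A.ring
instance (A : DGAlgebra R) : Algebra R A := A.algebra
instance (A : DGAlgebra R) : GradedAlgebra A.gr := A.graded

/-- A morphism of DG `R`-algebras. -/
structure Hom (A B : DGAlgebra R) where
  toAlgHom : A →ₐ[R] B
  map_gr : ∀ {i a}, a ∈ A.gr i → toAlgHom a ∈ B.gr i
  map_d : ∀ a, toAlgHom (A.d a) = B.d (toAlgHom a)

variable (A : DGAlgebra R)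

theorem d_zero {a : A} (ha : a ∈ A.gr 0) : A.d a = 0 := by
  have := A.d_mem ha
  rwa [A.gr_neg _ (by norm_num), Submodule.mem_bot] at this

/-- The subring `A₀`. -/
abbrev zero : Subring A := SetLike.GradeZero.subring A.gr

theorem mem_zero {a : A} : a ∈ A.zero ↔ a ∈ A.gr 0 := Iff.rfl

/-- The ideal `d(A₁)` of `A₀`. -/
def boundaryIdeal : Ideal A.zero where
  carrier := {a | ∃ b ∈ A.gr 1, A.d b = a}
  zero_mem' := ⟨0, zero_mem _, by simp⟩
  add_mem' := by
    rintro _ _ ⟨b, hb, h⟩ ⟨b', hb', h'⟩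
    exact ⟨b + b', add_mem hb hb', by simp [h, h']⟩
  smul_mem' := by
    rintro ⟨c, hc⟩ a ⟨b, hb, h⟩
    refine ⟨c * b, by simpa using SetLike.mul_mem_graded (A := A.gr) hc hb, ?_⟩
    rw [A.leibniz (i := 0) hc, A.d_zero hc]
    simp [h]

instance : A.boundaryIdeal.IsTwoSided where
  mul_mem_of_left := by
    rintro a ⟨c, hc⟩ ⟨b, hb, h⟩
    refine ⟨b * c, by simpa using SetLike.mul_mem_graded (A := A.gr) hb hc, ?_⟩
    rw [A.leibniz hb, A.d_zero hc]
    simp [h]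

/-- The ring `H₀(A) = A₀ / d(A₁)`. -/
abbrev H0 : Type u := A.zero ⧸ A.boundaryIdeal

/-- The sign involution is multiplicative. -/
theorem signMap_mul (a b : A) :
    DG.signMap A.gr (a * b) = DG.signMap A.gr a * DG.signMap A.gr b := by
  induction a using DirectSum.Decomposition.inductionOn A.gr with
  | zero => simp
  | add m m' h h' => simp [add_mul, h, h']
  | homogeneous a =>
    induction b using DirectSum.Decomposition.inductionOn A.gr with
    | zero => simp
    | add m m' h h' => simp [mul_add, h, h']
    | homogeneous b =>
      rw [DG.signMap_apply _ a.2, DG.signMap_apply _ b.2,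
        DG.signMap_apply _ (SetLike.mul_mem_graded a.2 b.2), Int.negOnePow_add, smul_mul_smul_comm]

theorem leibniz' (a b : A) : A.d (a * b) = A.d a * b + DG.signMap A.gr a * A.d b := by
  induction a using DirectSum.Decomposition.inductionOn A.gr with
  | zero => simp
  | add m m' h h' => simp only [add_mul, map_add, h, h']; abel
  | homogeneous a => rw [A.leibniz a.2, DG.signMap_apply _ a.2, smul_mul_assoc]

end DGAlgebra

/-- A (left) DG module over the DG `R`-algebra `A`. -/
structure DGModule {R : Type u} [CommRing R] (A : DGAlgebra R) where
  carrier : Type u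
  [addCommGroup : AddCommGroup carrier]
  [moduleR : Module R carrier]
  [moduleA : Module A carrier]
  [tower : IsScalarTower R A carrier]
  gr : ℤ → Submodule R carrier
  [decomposition : DirectSum.Decomposition gr]
  smul_mem : ∀ {i j a m}, a ∈ A.gr i → m ∈ gr j → (a • m : carrier) ∈ gr (i + j)
  d : carrier →ₗ[R] carrier
  d_mem : ∀ {i m}, m ∈ gr i → d m ∈ gr (i - 1)
  d_d : ∀ m, d (d m) = 0
  leibniz : ∀ {i a}, a ∈ A.gr i → ∀ m, d (a • m) = A.d a • m + i.negOnePow • (a • d m)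

namespace DGModule

variable {R : Type u} [CommRing R] {A : DGAlgebra R}

instance : CoeSort (DGModule A) (Type u) := ⟨carrier⟩

instance (M : DGModule A) : AddCommGroup M := M.addCommGroup
instance (M : DGModule A) : Module R M := M.moduleR
instance (M : DGModule A) : Module A M := M.moduleA
instance (M : DGModule A) : IsScalarTower R A M := M.tower
instance (M : DGModule A) : DirectSum.Decomposition M.gr := M.decomposition

set_option linter.unusedSimpArgs false in
theorem signMap_smul (M : DGModule A) (a : A) (m : M) :
    DG.signMap M.gr (a • m) = DG.signMap A.gr a • DG.signMap M.gr m := by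
  induction a using DirectSum.Decomposition.inductionOn A.gr with
  | zero => simp
  | add m m' h h' => simp [add_smul, h, h']
  | homogeneous a =>
    induction m using DirectSum.Decomposition.inductionOn M.gr with
    | zero => simp
    | add m m' h h' => simp [h, h']
    | homogeneous m =>
      rw [DG.signMap_apply _ a.2, DG.signMap_apply _ m.2,
        DG.signMap_apply _ (M.smul_mem a.2 m.2), Int.negOnePow_add]
      rename_i i j
      rcases Int.units_eq_one_or i.negOnePow with h | h <;>
      rcases Int.units_eq_one_or j.negOnePow with h' | h' <;>
      rw [h, h'] <;>
      simp only [one_smul, Units.neg_smul, mul_one, one_mul, neg_mul, mul_neg, neg_neg,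
        smul_neg, neg_smul]

theorem leibniz' (M : DGModule A) (a : A) (m : M) :
    M.d (a • m) = A.d a • m + DG.signMap A.gr a • M.d m := by
  induction a using DirectSum.Decomposition.inductionOn A.gr with
  | zero => simp
  | add m m' h h' => simp only [add_smul, map_add, h, h']; abel
  | homogeneous a => rw [M.leibniz a.2, DG.signMap_apply _ a.2, smul_assoc]

section Homology

variable (M N P : DGModule A)

/-- The cycles of degree `i`, an `A₀`-module. -/
def cycles (i : ℤ) : Submodule A.zero M where
  carrier := {m | m ∈ M.gr i ∧ M.d m = 0}
  zero_mem' := ⟨zero_mem _, map_zero _⟩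
  add_mem' := fun h h' => ⟨add_mem h.1 h'.1, by rw [map_add, h.2, h'.2, add_zero]⟩
  smul_mem' := by
    rintro ⟨a, ha⟩ m ⟨hm, hd⟩
    refine ⟨by have := M.smul_mem (i := 0) ha hm; rwa [zero_add] at this, ?_⟩
    change M.d (a • m) = 0
    rw [M.leibniz (i := 0) ha, A.d_zero ha, hd]
    simp

/-- The boundaries of degree `i`, an `A₀`-module. -/
def boundaries (i : ℤ) : Submodule A.zero M where
  carrier := {m | ∃ n ∈ M.gr (i + 1), M.d n = m}
  zero_mem' := ⟨0, zero_mem _, map_zero _⟩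
  add_mem' := by
    rintro _ _ ⟨b, hb, h⟩ ⟨b', hb', h'⟩
    exact ⟨b + b', add_mem hb hb', by simp [h, h']⟩
  smul_mem' := by
    rintro ⟨a, ha⟩ _ ⟨m, hm, rfl⟩
    refine ⟨a • m, by simpa using M.smul_mem (i := 0) ha hm, ?_⟩
    change M.d (a • m) = a • M.d m
    rw [M.leibniz (i := 0) ha, A.d_zero ha]
    simp

theorem boundaries_le_cycles (i : ℤ) : M.boundaries i ≤ M.cycles i := by
  rintro _ ⟨n, hn, rfl⟩
  exact ⟨by simpa using M.d_mem hn, M.d_d n⟩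

/-- The homology `Hᵢ(M)`. -/
def homology (i : ℤ) : Type u := M.cycles i ⧸ (M.boundaries i).submoduleOf (M.cycles i)

instance (i : ℤ) : AddCommGroup (M.homology i) :=
  inferInstanceAs (AddCommGroup (M.cycles i ⧸ (M.boundaries i).submoduleOf (M.cycles i)))

instance (i : ℤ) : Module A.zero (M.homology i) :=
  inferInstanceAs (Module A.zero (M.cycles i ⧸ (M.boundaries i).submoduleOf (M.cycles i)))

theorem homology_isTorsion (i : ℤ) :
    Module.IsTorsionBySet A.zero (M.homology i) A.boundaryIdeal := by
  rintro x ⟨⟨a, ha⟩, hI⟩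
  obtain ⟨b, hb, rfl⟩ : ∃ b ∈ A.gr 1, A.d b = a := hI
  induction x using Submodule.Quotient.induction_on with
  | H z =>
    refine (Submodule.Quotient.mk_eq_zero _).2 ⟨b • (z : M), ?_, ?_⟩
    · simpa [add_comm] using M.smul_mem hb z.2.1
    · rw [M.leibniz hb, z.2.2]
      simp
      rfl

/-- `Hᵢ(M)` is an `H₀(A)`-module. -/
instance (i : ℤ) : Module A.H0 (M.homology i) := (M.homology_isTorsion i).module

/-- `Hᵢ(M) = 0` for `i ≪ 0`. -/
def HomologicallyBoundedBelow : Prop := ∃ n : ℤ, ∀ i < n, Subsingleton (M.homology i)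

/-- Each `Hᵢ(M)` is finitely generated over `H₀(A)`. -/
def HomologicallyDegreewiseFinite : Prop := ∀ i : ℤ, Module.Finite A.H0 (M.homology i)

/-- A morphism of DG `A`-modules. -/
structure Hom where
  toLinearMap : M →ₗ[A] N
  map_gr : ∀ {i m}, m ∈ M.gr i → toLinearMap m ∈ N.gr i
  map_d : ∀ m, toLinearMap (M.d m) = N.d (toLinearMap m)

variable {M N}

theorem Hom.map_cycles (f : Hom M N) (i : ℤ) :
    ∀ m ∈ M.cycles i, f.toLinearMap.restrictScalars A.zero m ∈ N.cycles i :=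
  fun m hm => ⟨f.map_gr hm.1, by
    change N.d (f.toLinearMap m) = 0
    rw [← f.map_d, hm.2, map_zero]⟩

theorem Hom.map_boundaries (f : Hom M N) (i : ℤ) :
    (M.boundaries i).submoduleOf (M.cycles i) ≤
      ((N.boundaries i).submoduleOf (N.cycles i)).comap
        ((f.toLinearMap.restrictScalars A.zero).restrict (f.map_cycles i)) := by
  rintro ⟨_, _⟩ ⟨n, hn, rfl⟩
  exact ⟨f.toLinearMap n, f.map_gr hn, (f.map_d n).symm⟩

/-- The map induced on homology. -/
def Hom.homologyMap (f : Hom M N) (i : ℤ) : M.homology i →ₗ[A.zero] N.homology i :=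
  Submodule.mapQ _ _ ((f.toLinearMap.restrictScalars A.zero).restrict (f.map_cycles i))
    (f.map_boundaries i)

/-- Quasiisomorphisms: the morphisms inducing bijections on all homology modules. -/
def Hom.IsQuasiIso (f : Hom M N) : Prop := ∀ i, Function.Bijective (f.homologyMap i)

/-- `M ≃ N`: there is a finite zigzag of quasiisomorphisms between `M` and `N`. -/
def QuasiIsomorphic : DGModule A → DGModule A → Prop :=
  Relation.EqvGen fun M N => ∃ f : Hom M N, f.IsQuasiIso

variable (M N)

/-- A semi-free DG module: it is bounded below and its underlying `A`-module has a basis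
of homogeneous elements (a semi-basis). -/
def IsSemifree : Prop :=
  (∃ n : ℤ, ∀ i < n, M.gr i = ⊥) ∧
    ∃ (E : Type u) (b : Module.Basis E A M), ∀ e, ∃ i, b e ∈ M.gr i

/-- A semi-free resolution of `M`. -/
structure SemifreeResolution where
  F : DGModule A
  isSemifree : F.IsSemifree
  map : Hom F M
  isQuasiIso : map.IsQuasiIso

/-- The DG `A`-module homomorphisms `M → N` of degree `p`. -/
def homDeg (p : ℤ) : Submodule R (M →ₗ[R] N) where
  carrier := {f | (∀ i, ∀ m ∈ M.gr i, f m ∈ N.gr (i + p)) ∧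
    ∀ i, ∀ a ∈ A.gr i, ∀ m : M, f (a • m) = (p * i).negOnePow • (a • f m)}
  zero_mem' := by simp
  add_mem' := fun hf hg => ⟨fun i m hm => add_mem (hf.1 i m hm) (hg.1 i m hm), fun i a ha m => by
    simp [hf.2 i a ha m, hg.2 i a ha m]⟩
  smul_mem' := fun r f hf => ⟨fun i m hm => Submodule.smul_mem _ _ (hf.1 i m hm),
    fun i a ha m => by
      rw [LinearMap.smul_apply, LinearMap.smul_apply, hf.2 i a ha m, smul_comm r, smul_comm r]⟩

/-- The differential of the Hom complex in degree `p`. -/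
def homD (p : ℤ) : (M →ₗ[R] N) →ₗ[R] (M →ₗ[R] N) where
  toFun f := N.d ∘ₗ f - p.negOnePow • (f ∘ₗ M.d)
  map_add' f g := by
    rw [LinearMap.comp_add, LinearMap.add_comp, smul_add]; abel
  map_smul' r f := by
    rw [LinearMap.comp_smul, LinearMap.smul_comp, smul_comm _ r, ← smul_sub, RingHom.id_apply]

theorem homD_apply (p : ℤ) (f : M →ₗ[R] N) (m : M) :
    homD M N p f m = N.d (f m) - p.negOnePow • f (M.d m) := rfl

/-- The cycles of degree `p` in `Hom_A(M, N)`. -/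
def homCycles (p : ℤ) : Submodule R (M →ₗ[R] N) := homDeg M N p ⊓ LinearMap.ker (homD M N p)

/-- The boundaries (null-homotopic homomorphisms) of degree `p` in `Hom_A(M, N)`. -/
def homBoundaries (p : ℤ) : Submodule R (M →ₗ[R] N) :=
  (homDeg M N (p + 1)).map (homD M N (p + 1))

set_option linter.unusedSimpArgs false in
theorem homBoundaries_le_homCycles (p : ℤ) : homBoundaries M N p ≤ homCycles M N p := by
  rintro _ ⟨f, ⟨hf, hf'⟩, rfl⟩
  refine ⟨⟨fun i m hm => ?_, fun i a ha m => ?_⟩, ?_⟩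
  · rw [homD_apply]
    refine sub_mem ?_ ?_
    · have := N.d_mem (hf i m hm)
      rwa [show i + (p + 1) - 1 = i + p by ring] at this
    · rw [Units.smul_def]
      refine zsmul_mem ?_ _
      have := hf _ _ (M.d_mem hm)
      rwa [show i - 1 + (p + 1) = i + p by ring] at this
  · rw [homD_apply, homD_apply, hf' i a ha, M.leibniz ha, map_add, hf' _ _ (A.d_mem ha)]
    have e1 : ∀ (u : ℤˣ) (x : N), N.d (u • x) = u • N.d x := fun u x => by
      simp [Units.smul_def]
    have e2 : ∀ (u : ℤˣ) (x : M), f (u • x) = u • f x := fun u x => by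
      simp [Units.smul_def]
    have e3 : ∀ (u : ℤˣ) (x : N), a • (u • x) = u • (a • x) := fun u x => by
      rcases Int.units_eq_one_or u with rfl | rfl <;>
      simp only [one_smul, Units.neg_smul, smul_neg]
    rw [e1, e2, N.leibniz ha, hf' i a ha, smul_sub, e3]
    simp only [add_mul, mul_sub, one_mul, mul_one, Int.negOnePow_add, Int.negOnePow_sub,
      Int.negOnePow_one, smul_sub, smul_add, smul_smul]
    generalize p.negOnePow = u
    generalize i.negOnePow = v
    generalize (p * i).negOnePow = w
    generalize A.d a • f m = x
    generalize a • N.d (f m) = y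
    generalize a • f (M.d m) = z
    rcases Int.units_eq_one_or u with rfl | rfl <;>
    rcases Int.units_eq_one_or v with rfl | rfl <;>
    rcases Int.units_eq_one_or w with rfl | rfl <;>
    simp only [one_smul, Units.neg_smul, mul_one, one_mul, neg_mul, mul_neg, neg_neg,
      smul_neg, neg_add_rev, inv_one, inv_neg, neg_sub] <;> abel
  · refine LinearMap.mem_ker.2 ?_
    ext m
    simp [homD_apply, Units.smul_def, N.d_d, M.d_d, Int.negOnePow_succ]

/-- `H_p(Hom_A(M, N))`. -/
abbrev homHomology (p : ℤ) : Type u :=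
  homCycles M N p ⧸ (homBoundaries M N p).submoduleOf (homCycles M N p)

variable {M}

/-- `Ext^i_A(M, N) = H_{-i}(Hom_A(F, N))`, computed with the semi-free resolution `F → M`. -/
abbrev SemifreeResolution.Ext (F : SemifreeResolution M) (i : ℤ) : Type u :=
  homHomology F.F N (-i)

end Homology

end DGModule

namespace DGAlgebra

variable {R : Type u} [CommRing R]

/-- The grading of `R[e]/(e²)` with `|e| = 1`. -/
def koszulGr (R : Type u) [CommRing R] (n : ℤ) : Submodule R (DualNumber R) where
  carrier := {x | (n ≠ 0 → x.fst = 0) ∧ (n ≠ 1 → x.snd = 0)}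
  zero_mem' := by simp
  add_mem' := fun {x y} hx hy =>
    ⟨fun h => by simp [hx.1 h, hy.1 h], fun h => by simp [hx.2 h, hy.2 h]⟩
  smul_mem' := fun r x hx => ⟨fun h => by simp [hx.1 h], fun h => by simp [hx.2 h]⟩

theorem koszulGr_mul {i j : ℤ} {x y : DualNumber R} (hx : x ∈ koszulGr R i)
    (hy : y ∈ koszulGr R j) : x * y ∈ koszulGr R (i + j) := by
  obtain ⟨hx, hx'⟩ := hx
  obtain ⟨hy, hy'⟩ := hy
  refine ⟨fun h => ?_, fun h => ?_⟩
  · by_cases hi : i = 0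
    · have : j ≠ 0 := by omega
      simp [hy this]
    · simp [hx hi]
  · have h1 : x.fst * y.snd = 0 := by
      by_cases hi : i = 0
      · rw [hy' (by omega), mul_zero]
      · rw [hx hi, zero_mul]
    have h2 : x.snd * y.fst = 0 := by
      by_cases hi : j = 0
      · rw [hx' (by omega), zero_mul]
      · rw [hy hi, mul_zero]
    simp [h1, h2]

theorem inl_mem_koszulGr (r : R) : TrivSqZeroExt.inl r ∈ koszulGr R 0 :=
  ⟨by simp, fun _ => TrivSqZeroExt.snd_inl R r⟩

theorem inr_mem_koszulGr (r : R) : TrivSqZeroExt.inr r ∈ koszulGr R 1 :=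
  ⟨fun _ => TrivSqZeroExt.fst_inr R r, by simp⟩

instance : GradedAlgebra (koszulGr R) where
  one_mem := inl_mem_koszulGr 1
  mul_mem _ _ _ _ hx hy := koszulGr_mul hx hy
  toDecomposition := DirectSum.Decomposition.ofAddHom _
    ((DirectSum.of (fun i => koszulGr R i) 0).comp
        (AddMonoidHom.mk' (fun x : DualNumber R => ⟨.inl x.fst, inl_mem_koszulGr _⟩)
          fun a b => by ext <;> simp) +
      (DirectSum.of (fun i => koszulGr R i) 1).comp
        (AddMonoidHom.mk' (fun x : DualNumber R => ⟨.inr x.snd, inr_mem_koszulGr _⟩)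
          fun a b => by ext <;> simp))
    (by
      ext x <;> simp)
    (by
      ext i ⟨x, hx, hx'⟩ : 2
      simp only [AddMonoidHom.comp_apply, DirectSum.coeAddMonoidHom_of, AddMonoidHom.add_apply,
        AddMonoidHom.mk'_apply, AddMonoidHom.id_apply]
      by_cases h0 : i = 0
      · subst h0
        have e : (⟨.inr x.snd, inr_mem_koszulGr _⟩ : koszulGr R 1) = 0 :=
          Subtype.ext (by simp [hx' (by norm_num)])
        rw [e, map_zero, add_zero]
        congr 1
        exact Subtype.ext (TrivSqZeroExt.ext (by simp) (by simp [hx' (by norm_num)]))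
      · have e : (⟨.inl x.fst, inl_mem_koszulGr _⟩ : koszulGr R 0) = 0 :=
          Subtype.ext (by simp [hx h0])
        rw [e, map_zero, zero_add]
        by_cases h1 : i = 1
        · subst h1
          congr 1
          exact Subtype.ext (TrivSqZeroExt.ext (by simp [hx h0]) (by simp))
        · have e : (⟨.inr x.snd, inr_mem_koszulGr _⟩ : koszulGr R 1) = 0 :=
            Subtype.ext (by simp [hx' h1])
          have e' : (⟨x, hx, hx'⟩ : koszulGr R i) = 0 :=
            Subtype.ext (TrivSqZeroExt.ext (hx h0) (hx' h1))
          rw [e, e', map_zero, map_zero])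

/-- The Koszul complex `K^R(t) : 0 → R e → R → 0`, `d e = t`, as a DG `R`-algebra. Its underlying
algebra is `R[e]/(e²)`. -/
def koszul (t : R) : DGAlgebra R where
  carrier := DualNumber R
  gr := koszulGr R
  gr_neg := fun i hi => by
    rw [eq_bot_iff]
    rintro x ⟨h, h'⟩
    exact TrivSqZeroExt.ext (h (by omega)) (h' (by omega))
  d :=
    { toFun := fun x => .inl (t * x.snd)
      map_add' := fun x y => by ext <;> simp [mul_add]
      map_smul' := fun r x => by ext <;> simp [mul_left_comm] }
  d_mem := by
    rintro i x ⟨h, h'⟩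
    refine ⟨fun hi => ?_, fun hi => ?_⟩
    · simp [h' (by omega)]
    · simp
  d_d := by intro a; ext <;> simp
  leibniz := by
    rintro i a ⟨h, h'⟩ b
    by_cases h0 : i = 0
    · subst h0
      ext <;> simp [h' (by norm_num)]
      ring
    · by_cases h1 : i = 1
      · subst h1
        ext <;> simp [h (by norm_num)] <;> ring
      · obtain rfl : a = 0 := TrivSqZeroExt.ext (h h0) (h' h1)
        ext <;> simp
  comm := by
    rintro i j a b ⟨h, h'⟩ ⟨k, k'⟩
    by_cases h0 : i = 0
    · subst h0
      simp [mul_comm]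
    · by_cases h1 : j = 0
      · subst h1
        simp [mul_comm]
      · ext <;> simp [h h0, k h1, Units.smul_def]
  sq_zero := by
    rintro i a hi ⟨h, h'⟩
    have : i ≠ 0 := by rintro rfl; simp at hi
    ext <;> simp [h this]

section Tensor

variable (K A : DGAlgebra R)

/-- The underlying algebra of `K ⊗_R A`: the tensor product `K ⊗[R] A` with the multiplication
`(x ⊗ a) * (x' ⊗ a') = (-1)^(|a| * |x'|) (x * x') ⊗ (a * a')`. -/
abbrev TensorCarrier : Type u := GradedTensorProduct R K.gr A.gr

/-- The bilinear map `(x, a) ↦ x ⊗ a`. -/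
def tmul : K →ₗ[R] A →ₗ[R] TensorCarrier K A :=
  (TensorProduct.mk R K A).compr₂ (GradedTensorProduct.of R K.gr A.gr).toLinearMap

variable {K A} in
theorem tmul_mul_tmul {j i : ℤ} {a : A} {x' : K} (x : K) (ha : a ∈ A.gr j) (hx' : x' ∈ K.gr i)
    (a' : A) : tmul K A x a * tmul K A x' a' =
      (j * i).negOnePow • tmul K A (x * x') (a * a') :=
  GradedTensorProduct.tmul_coe_mul_coe_tmul K.gr A.gr x ⟨a, ha⟩ ⟨x', hx'⟩ a'

/-- Linear maps out of the tensor product. -/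
def tensorLift {P : Type*} [AddCommGroup P] [Module R P] (f : K →ₗ[R] A →ₗ[R] P) :
    TensorCarrier K A →ₗ[R] P :=
  TensorProduct.lift f ∘ₗ (GradedTensorProduct.of R K.gr A.gr).symm.toLinearMap

@[simp] theorem tensorLift_tmul {P : Type*} [AddCommGroup P] [Module R P]
    (f : K →ₗ[R] A →ₗ[R] P) (x : K) (a : A) : tensorLift K A f (tmul K A x a) = f x a :=
  TensorProduct.lift.tmul x a

theorem tmul_span (p : TensorCarrier K A) :
    p ∈ Submodule.span R {x | ∃ m n, x = tmul K A m n} := by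
  change K ⊗[R] A at p
  induction p using TensorProduct.induction_on with
  | zero => exact zero_mem _
  | add x y hx hy => exact add_mem hx hy
  | tmul x y => exact Submodule.subset_span ⟨x, y, rfl⟩

variable {K A} in
theorem tensor_induction {motive : TensorCarrier K A → Prop} (zero : motive 0)
    (add : ∀ x y, motive x → motive y → motive (x + y))
    (tmul : ∀ i j x a, x ∈ K.gr i → a ∈ A.gr j → motive (tmul K A x a)) (p) : motive p := by
  change K ⊗[R] A at p
  induction p using TensorProduct.induction_on with
  | zero => exact zero
  | add x y hx hy => exact add x y hx hy
  | tmul x a =>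
    change motive (DGAlgebra.tmul K A x a)
    induction x using DirectSum.Decomposition.inductionOn K.gr with
    | zero => simpa using zero
    | add m m' h h' => rw [LinearMap.map_add₂]; exact add _ _ h h'
    | homogeneous x =>
      induction a using DirectSum.Decomposition.inductionOn A.gr with
      | zero => simpa using zero
      | add m m' h h' => rw [map_add]; exact add _ _ h h'
      | homogeneous a => exact tmul _ _ _ _ x.2 a.2

/-- The degree `n` part `⨁_{i + j = n} K_i ⊗ A_j`. -/
abbrev tensorGr : ℤ → Submodule R (TensorCarrier K A) := DG.totalGr K.gr A.gr (tmul K A)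

variable {K A} in
theorem tensorGr_induction {n : ℤ} {motive : ∀ p, p ∈ tensorGr K A n → Prop}
    (zero : motive 0 (zero_mem _))
    (add : ∀ x y hx hy, motive x hx → motive y hy → motive (x + y) (add_mem hx hy))
    (tmul : ∀ i j x a (hx : x ∈ K.gr i) (ha : a ∈ A.gr j) (h : i + j = n),
      motive (tmul K A x a) (DG.mem_totalGr hx ha h))
    {p} (hp : p ∈ tensorGr K A n) : motive p hp := by
  induction hp using Submodule.closure_induction with
  | zero => exact zero
  | add x y hx' hy' hx hy => exact add x y hx' hy' hx hy
  | smul_mem r x h =>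
    obtain ⟨i, j, m, a, hm, ha, h, rfl⟩ := h
    have := tmul i j (r • m) _ (Submodule.smul_mem _ r hm) ha h
    simpa only [LinearMap.map_smul₂] using this

instance tensorDecomposition : DirectSum.Decomposition (tensorGr K A) :=
  DG.totalDecomposition K.gr A.gr (tmul K A)
    (tensorLift K A (DG.totalDec K.gr A.gr (tmul K A)))
    (fun m n => tensorLift_tmul K A _ m n) (tmul_span K A)

/-- The differential `x ⊗ a ↦ d x ⊗ a + (-1)^{|x|} x ⊗ d a`. -/
def tensorD : TensorCarrier K A →ₗ[R] TensorCarrier K A :=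
  tensorLift K A ((tmul K A).compl₁₂ K.d LinearMap.id +
    (tmul K A).compl₁₂ (DG.signMap K.gr) A.d)

variable {K A} in
theorem tensorD_tmul {i : ℤ} {x : K} (hx : x ∈ K.gr i) (a : A) :
    tensorD K A (tmul K A x a) = tmul K A (K.d x) a + i.negOnePow • tmul K A x (A.d a) := by
  simp [tensorD, DG.signMap_apply _ hx]

variable {K A} in
theorem tensorD_mem {n : ℤ} {p : TensorCarrier K A} (hp : p ∈ tensorGr K A n) :
    tensorD K A p ∈ tensorGr K A (n - 1) := by
  induction hp using tensorGr_induction with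
  | zero => rw [map_zero]; exact zero_mem _
  | add x y _ _ hx hy => rw [map_add]; exact add_mem hx hy
  | tmul i j x a hx ha h =>
    rw [tensorD_tmul hx, Units.smul_def]
    exact add_mem (DG.mem_totalGr (K.d_mem hx) ha (by omega))
      (zsmul_mem (DG.mem_totalGr hx (A.d_mem ha) (by omega)) _)

theorem tensorD_d (p : TensorCarrier K A) : tensorD K A (tensorD K A p) = 0 := by
  induction p using tensor_induction with
  | zero => simp
  | add x y hx hy => simp [hx, hy]
  | tmul i j x a hx ha =>
    rw [tensorD_tmul hx, map_add, DG.map_units_smul, tensorD_tmul hx, tensorD_tmul (K.d_mem hx),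
      K.d_d, A.d_d, Int.negOnePow_sub]
    simp

instance tensorGradedMonoid : SetLike.GradedMonoid (tensorGr K A) where
  one_mem := DG.mem_totalGr (β := tmul K A) (SetLike.one_mem_graded K.gr)
    (SetLike.one_mem_graded A.gr) (add_zero 0)
  mul_mem n n' p p' hp hp' := by
    induction hp using tensorGr_induction with
    | zero => rw [zero_mul]; exact zero_mem _
    | add x y _ _ hx hy => rw [add_mul]; exact add_mem hx hy
    | tmul i j x a hx ha h =>
      induction hp' using tensorGr_induction with
      | zero => rw [mul_zero]; exact zero_mem _
      | add x y _ _ hx hy => rw [mul_add]; exact add_mem hx hy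
      | tmul i' j' x' a' hx' ha' h' =>
        rw [tmul_mul_tmul _ ha hx', Units.smul_def]
        exact zsmul_mem (DG.mem_totalGr (SetLike.mul_mem_graded hx hx')
          (SetLike.mul_mem_graded ha ha') (by omega)) _

variable {K A} in
set_option linter.unusedSimpArgs false in
theorem tensorD_leibniz {n : ℤ} {p : TensorCarrier K A} (hp : p ∈ tensorGr K A n)
    (q : TensorCarrier K A) : tensorD K A (p * q) =
      tensorD K A p * q + n.negOnePow • (p * tensorD K A q) := by
  induction hp using tensorGr_induction with
  | zero => simp
  | add x y _ _ hx hy => simp only [add_mul, map_add, hx, hy, smul_add]; abel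
  | tmul i j x a hx ha h =>
    subst h
    induction q using tensor_induction with
    | zero => simp
    | add y z hy hz => simp only [mul_add, map_add, hy, hz, smul_add]; abel
    | tmul i' j' x' a' hx' ha' =>
      rw [tmul_mul_tmul _ ha hx', DG.map_units_smul, tensorD_tmul (SetLike.mul_mem_graded hx hx'),
        tensorD_tmul hx, tensorD_tmul hx', K.leibniz hx, A.leibniz ha, add_mul, mul_add,
        DG.units_smul_mul, DG.mul_units_smul, tmul_mul_tmul _ ha hx', tmul_mul_tmul _ (A.d_mem ha) hx',
        tmul_mul_tmul _ ha (K.d_mem hx'), tmul_mul_tmul _ ha hx']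
      simp only [map_add, LinearMap.add_apply, DG.map_units_smul₂]
      simp only [DG.map_units_smul,
        Int.negOnePow_add, smul_add, smul_smul, sub_mul, mul_sub, Int.negOnePow_sub, one_mul,
        mul_one]
      generalize i.negOnePow = u
      generalize j.negOnePow = v
      generalize i'.negOnePow = v'
      generalize (j * i').negOnePow = w
      generalize tmul K A (K.d x * x') (a * a') = y₁
      generalize tmul K A (x * K.d x') (a * a') = y₂
      generalize tmul K A (x * x') (A.d a * a') = y₃
      generalize tmul K A (x * x') (a * A.d a') = y₄
      rcases Int.units_eq_one_or u with rfl | rfl <;>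
      rcases Int.units_eq_one_or v with rfl | rfl <;>
      rcases Int.units_eq_one_or v' with rfl | rfl <;>
      rcases Int.units_eq_one_or w with rfl | rfl <;>
      simp only [one_smul, Units.neg_smul, mul_one, one_mul, neg_mul, mul_neg, neg_neg,
        smul_neg, inv_one, inv_neg] <;> abel

variable {K A} in
theorem tensor_comm {n n' : ℤ} {p q : TensorCarrier K A} (hp : p ∈ tensorGr K A n)
    (hq : q ∈ tensorGr K A n') : p * q = (n * n').negOnePow • (q * p) := by
  induction hp using tensorGr_induction with
  | zero => simp
  | add x y _ _ hx hy => simp only [add_mul, mul_add, hx, hy, smul_add]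
  | tmul i j x a hx ha h =>
    subst h
    induction hq using tensorGr_induction with
    | zero => simp
    | add x y _ _ hx hy => simp only [add_mul, mul_add, hx, hy, smul_add]
    | tmul i' j' x' a' hx' ha' h =>
      subst h
      rw [tmul_mul_tmul _ ha hx', tmul_mul_tmul _ ha' hx, K.comm hx hx', A.comm ha ha',
        DG.map_units_smul, DG.map_units_smul₂]
      simp only [smul_smul, add_mul, mul_add, Int.negOnePow_add]
      rw [mul_comm j' i]
      congr 1
      generalize (i * i').negOnePow = u
      generalize (j * j').negOnePow = v
      generalize (j * i').negOnePow = w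
      generalize (i * j').negOnePow = x
      rcases Int.units_eq_one_or x with rfl | rfl <;>
      simp [mul_comm, mul_left_comm]

variable {K A} in
theorem tensor_sq_zero {n : ℤ} {p : TensorCarrier K A} (hn : Odd n) (hp : p ∈ tensorGr K A n) :
    p * p = 0 := by
  have key : p ∈ tensorGr K A n ∧ p * p = 0 := by
    induction hp using tensorGr_induction with
    | zero => exact ⟨zero_mem _, by simp⟩
    | add x y _ _ hx hy =>
      refine ⟨add_mem hx.1 hy.1, ?_⟩
      have := tensor_comm hx.1 hy.1
      rw [Int.negOnePow_odd _ (hn.mul hn)] at this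
      rw [add_mul, mul_add, mul_add, hx.2, hy.2, this]
      simp
    | tmul i j x a hx ha h =>
      refine ⟨DG.mem_totalGr hx ha h, ?_⟩
      rw [tmul_mul_tmul _ ha hx]
      rcases Int.even_or_odd i with hi | hi
      · have hj : Odd j := by
          rw [← h] at hn
          exact (Int.odd_add'.1 hn).2 hi
        simp [A.sq_zero hj ha]
      · simp [K.sq_zero hi hx]
  exact key.2

/-- The tensor product `K ⊗_R A` of DG `R`-algebras. -/
def tensor : DGAlgebra R where
  carrier := TensorCarrier K A
  gr := tensorGr K A
  graded := { tensorGradedMonoid K A, tensorDecomposition K A with }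
  gr_neg n hn := by
    rw [eq_bot_iff]
    intro p hp
    induction hp using tensorGr_induction with
    | zero => exact zero_mem _
    | add x y _ _ hx hy => exact add_mem hx hy
    | tmul i j x a hx ha h =>
      rcases lt_or_ge i 0 with hi | hi
      · rw [K.gr_neg i hi] at hx
        simp [(Submodule.mem_bot R).1 hx]
      · rw [A.gr_neg j (by omega)] at ha
        simp [(Submodule.mem_bot R).1 ha]
  d := tensorD K A
  d_mem := tensorD_mem
  d_d := tensorD_d K A
  leibniz := tensorD_leibniz
  comm := tensor_comm
  sq_zero := tensor_sq_zero

/-- The morphism of DG algebras `A → K ⊗_R A`, `a ↦ 1 ⊗ a`. -/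
def tensorRight : Hom A (tensor K A) where
  toAlgHom := GradedTensorProduct.includeRight K.gr A.gr
  map_gr ha := DG.mem_totalGr (β := tmul K A) (SetLike.one_mem_graded K.gr) ha (zero_add _)
  map_d a := by
    change tmul K A 1 (A.d a) = tensorD K A (tmul K A 1 a)
    rw [tensorD_tmul (SetLike.one_mem_graded K.gr), K.d_zero (SetLike.one_mem_graded K.gr)]
    simp

end Tensor

end DGAlgebra

namespace DGModule

variable {R : Type u} [CommRing R]

section BaseChange

variable {T S : DGAlgebra R} (f : DGAlgebra.Hom T S) (M : DGModule T)

/-- The relations `(s * f a) ⊗ m = s ⊗ (a • m)` defining `S ⊗_T M` as a quotient of `S ⊗_R M`. -/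
def baseChangeRel : Submodule S (S ⊗[R] M) :=
  Submodule.span S {x | ∃ (s : S) (a : T) (m : M),
    x = (s * f.toAlgHom a) ⊗ₜ[R] m - s ⊗ₜ[R] (a • m)}

/-- The underlying `S`-module of `S ⊗_T M`. -/
abbrev BaseChangeCarrier : Type u := (S ⊗[R] M) ⧸ baseChangeRel f M

/-- The bilinear map `(s, m) ↦ s ⊗ m`. -/
def bmul : S →ₗ[R] M →ₗ[R] BaseChangeCarrier f M :=
  (TensorProduct.mk R S M).compr₂ ((baseChangeRel f M).mkQ.restrictScalars R)

theorem bmul_smul (s : S) (a : T) (m : M) :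
    bmul f M s (a • m) = bmul f M (s * f.toAlgHom a) m := by
  symm
  exact (Submodule.Quotient.eq _).2 (Submodule.subset_span ⟨s, a, m, rfl⟩)

theorem smul_bmul (s s' : S) (m : M) : s • bmul f M s' m = bmul f M (s * s') m := rfl

variable {f M} in
/-- Linear maps out of `S ⊗_T M`. -/
def baseChangeLift {P : Type*} [AddCommGroup P] [Module R P] (g : S →ₗ[R] M →ₗ[R] P)
    (hg : ∀ s a m, g (s * f.toAlgHom a) m = g s (a • m)) : BaseChangeCarrier f M →ₗ[R] P :=
  ((baseChangeRel f M).restrictScalars R).liftQ (TensorProduct.lift g) (by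
    intro x hx
    have key : ∀ s : S, TensorProduct.lift g (s • x) = 0 := by
      replace hx : x ∈ baseChangeRel f M := hx
      induction hx using Submodule.span_induction with
      | mem x h =>
        obtain ⟨s', a, m, rfl⟩ := h
        intro s
        rw [smul_sub, TensorProduct.smul_tmul', TensorProduct.smul_tmul', map_sub,
          TensorProduct.lift.tmul, TensorProduct.lift.tmul, smul_eq_mul, smul_eq_mul, ← mul_assoc,
          hg, sub_self]
      | zero => simp
      | add x y _ _ hx hy => intro s; rw [smul_add, map_add, hx, hy, add_zero]
      | smul a x _ hx => intro s; rw [smul_smul, hx]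
    simpa using key 1) ∘ₗ
  (Submodule.Quotient.restrictScalarsEquiv R (baseChangeRel f M)).symm.toLinearMap

@[simp] theorem baseChangeLift_bmul {P : Type*} [AddCommGroup P] [Module R P]
    (g : S →ₗ[R] M →ₗ[R] P) (hg : ∀ s a m, g (s * f.toAlgHom a) m = g s (a • m))
    (s : S) (m : M) : baseChangeLift g hg (bmul f M s m) = g s m :=
  TensorProduct.lift.tmul s m

theorem bmul_span (p : BaseChangeCarrier f M) :
    p ∈ Submodule.span R {x | ∃ s m, x = bmul f M s m} := by
  induction p using Submodule.Quotient.induction_on with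
  | H p =>
    induction p using TensorProduct.induction_on with
    | zero => exact zero_mem _
    | add x y hx hy => exact add_mem hx hy
    | tmul x y => exact Submodule.subset_span ⟨x, y, rfl⟩

variable {f M} in
theorem baseChange_induction {motive : BaseChangeCarrier f M → Prop} (zero : motive 0)
    (add : ∀ x y, motive x → motive y → motive (x + y))
    (tmul : ∀ s m, motive (bmul f M s m)) (p) : motive p := by
  induction p using Submodule.Quotient.induction_on with
  | H p =>
    induction p using TensorProduct.induction_on with
    | zero => exact zero
    | add x y hx hy => exact add _ _ hx hy
    | tmul x y => exact tmul x y

/-- The degree `n` part of `S ⊗_T M`, spanned by all `s ⊗ m` with `|s| + |m| = n`. -/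
abbrev baseChangeGr : ℤ → Submodule R (BaseChangeCarrier f M) :=
  DG.totalGr S.gr M.gr (bmul f M)

variable {f M} in
theorem baseChangeGr_induction {n : ℤ} {motive : ∀ p, p ∈ baseChangeGr f M n → Prop}
    (zero : motive 0 (zero_mem _))
    (add : ∀ x y hx hy, motive x hx → motive y hy → motive (x + y) (add_mem hx hy))
    (tmul : ∀ i j s m (hs : s ∈ S.gr i) (hm : m ∈ M.gr j) (h : i + j = n),
      motive (bmul f M s m) (DG.mem_totalGr hs hm h))
    {p} (hp : p ∈ baseChangeGr f M n) : motive p hp := by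
  induction hp using Submodule.closure_induction with
  | zero => exact zero
  | add x y hx' hy' hx hy => exact add x y hx' hy' hx hy
  | smul_mem r x h =>
    obtain ⟨i, j, m, a, hm, ha, h, rfl⟩ := h
    have := tmul i j (r • m) _ (Submodule.smul_mem _ r hm) ha h
    simpa only [LinearMap.map_smul₂] using this

theorem totalDec_bmul (s : S) (a : T) (m : M) :
    DG.totalDec S.gr M.gr (bmul f M) (s * f.toAlgHom a) m =
      DG.totalDec S.gr M.gr (bmul f M) s (a • m) := by
  induction s using DirectSum.Decomposition.inductionOn S.gr with
  | zero => simp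
  | add x y hx hy => simp only [add_mul, map_add, LinearMap.add_apply, hx, hy]
  | homogeneous s =>
    induction a using DirectSum.Decomposition.inductionOn T.gr with
    | zero => simp
    | add x y hx hy => simp only [mul_add, add_smul, map_add, LinearMap.add_apply, hx, hy]
    | homogeneous a =>
      induction m using DirectSum.Decomposition.inductionOn M.gr with
      | zero => simp
      | add x y hx hy => simp only [smul_add, map_add, hx, hy]
      | homogeneous m =>
        rw [DG.totalDec_apply _ _ _ (SetLike.mul_mem_graded s.2 (f.map_gr a.2)) m.2 rfl,
          DG.totalDec_apply _ _ _ s.2 (M.smul_mem a.2 m.2) (add_assoc _ _ _).symm]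
        congr 1
        exact Subtype.ext (bmul_smul f M _ _ _).symm

instance baseChangeDecomposition : DirectSum.Decomposition (baseChangeGr f M) :=
  DG.totalDecomposition S.gr M.gr (bmul f M)
    (baseChangeLift (DG.totalDec S.gr M.gr (bmul f M)) (totalDec_bmul f M))
    (fun s m => baseChangeLift_bmul f M _ _ s m) (bmul_span f M)

theorem map_signMap (a : T) :
    DG.signMap S.gr (f.toAlgHom a) = f.toAlgHom (DG.signMap T.gr a) := by
  induction a using DirectSum.Decomposition.inductionOn T.gr with
  | zero => simp
  | add x y hx hy => simp only [map_add, hx, hy]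
  | homogeneous a =>
    rw [DG.signMap_apply _ a.2, DG.signMap_apply _ (f.map_gr a.2)]
    exact (DG.map_units_smul f.toAlgHom.toLinearMap _ _).symm

/-- The differential `s ⊗ m ↦ d s ⊗ m + (-1)^{|s|} s ⊗ d m`. -/
def baseChangeD : BaseChangeCarrier f M →ₗ[R] BaseChangeCarrier f M :=
  baseChangeLift ((bmul f M).compl₁₂ S.d LinearMap.id +
    (bmul f M).compl₁₂ (DG.signMap S.gr) M.d) (by
    intro s a m
    simp only [LinearMap.add_apply, LinearMap.compl₁₂_apply, LinearMap.id_apply]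
    rw [S.leibniz', M.leibniz', S.signMap_mul, ← f.map_d, map_signMap]
    simp only [map_add, LinearMap.add_apply, bmul_smul]
    abel)

theorem baseChangeD_bmul' (s : S) (m : M) :
    baseChangeD f M (bmul f M s m) =
      bmul f M (S.d s) m + bmul f M (DG.signMap S.gr s) (M.d m) := by
  simp [baseChangeD]

theorem baseChangeD_bmul {i : ℤ} {s : S} (hs : s ∈ S.gr i) (m : M) :
    baseChangeD f M (bmul f M s m) =
      bmul f M (S.d s) m + i.negOnePow • bmul f M s (M.d m) := by
  rw [baseChangeD_bmul', DG.signMap_apply _ hs, DG.map_units_smul₂]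

/-- The base change `S ⊗_T M` of the DG `T`-module `M` along `f : T → S`. -/
def baseChange : DGModule S where
  carrier := BaseChangeCarrier f M
  gr := baseChangeGr f M
  smul_mem := by
    intro i j s p hs hp
    induction hp using baseChangeGr_induction with
    | zero => rw [smul_zero]; exact zero_mem _
    | add x y _ _ hx hy => rw [smul_add]; exact add_mem hx hy
    | tmul i' j' s' m hs' hm h =>
      rw [smul_bmul]
      exact DG.mem_totalGr (SetLike.mul_mem_graded hs hs') hm (by omega)
  d := baseChangeD f M
  d_mem := by
    intro n p hp
    induction hp using baseChangeGr_induction with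
    | zero => rw [map_zero]; exact zero_mem _
    | add x y _ _ hx hy => rw [map_add]; exact add_mem hx hy
    | tmul i j s m hs hm h =>
      rw [baseChangeD_bmul _ _ hs, Units.smul_def]
      exact add_mem (DG.mem_totalGr (S.d_mem hs) hm (by omega))
        (zsmul_mem (DG.mem_totalGr hs (M.d_mem hm) (by omega)) _)
  d_d := by
    intro p
    induction p using baseChange_induction with
    | zero => simp
    | add x y hx hy => rw [map_add, map_add, hx, hy, add_zero]
    | tmul s m =>
      induction s using DirectSum.Decomposition.inductionOn S.gr with
      | zero => simp
      | add x y hx hy => simp only [map_add, LinearMap.add_apply] at hx hy ⊢; rw [hx, hy, add_zero]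
      | homogeneous s =>
        rw [baseChangeD_bmul _ _ s.2, map_add, DG.map_units_smul, baseChangeD_bmul _ _ s.2,
          baseChangeD_bmul _ _ (S.d_mem s.2), S.d_d, M.d_d, Int.negOnePow_sub]
        simp
  leibniz := by
    intro i s hs p
    induction p using baseChange_induction with
    | zero => simp
    | add x y hx hy => simp only [smul_add, map_add, hx, hy]; abel
    | tmul s' m =>
      rw [smul_bmul, baseChangeD_bmul', baseChangeD_bmul', S.leibniz', S.signMap_mul, smul_add,
        smul_bmul, smul_bmul, smul_bmul, smul_add, DG.signMap_apply _ hs, DG.units_smul_mul,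
        DG.units_smul_mul, map_add, LinearMap.add_apply, DG.map_units_smul₂, DG.map_units_smul₂]
      abel

/-- `M` is a quasi-lifting of the DG `S`-module `D` to `T` (along `f : T → S`): `M` is a semi-free
DG `T`-module with `D ≃ S ⊗_T M`. -/
def IsQuasiLifting (D : DGModule S) : Prop :=
  M.IsSemifree ∧ QuasiIsomorphic D (baseChange f M)

end BaseChange

end DGModule

end

/-! Write `B` for `K ⊗ A` and `F → D` for a semi-free resolution over `B`. Vanishing of Ext means
that every cycle of degree `p = -d` in the relevant Hom complex is a boundary (`IsCycle`, `IsNull`),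
so the whole argument is carried out with maps and explicit homotopies.

Since `F` is semi-free, maps out of it lift through quasi-isomorphisms up to homotopy
(`SemiBasis.exists_lift`). Along the zigzag from `D` to `B ⊗ M` this yields a quasi-isomorphism `ρ :
F → B ⊗ M` and the vanishing of all classes of cycles `F → B ⊗ M`. By extension of scalars every
cycle `M → B ⊗ M` over `A` is then a boundary (`SemiBasis.isNull_of_quasiIso_baseChange`).

As a complex, `B ⊗ M = K ⊗ M` is the mapping cone of multiplication by `t` on `M`. If `z : M → M` is
a cycle, then `1 ⊗ z` is a boundary, and reading off the coefficients of `1` and `e` in the homotopy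
shows that `z` is homotopic to `t w` for a cycle `w` (`exists_isNull_sub_smul`). So Ext is
`t`-divisible: it equals `t` times itself.

It remains to apply a Nakayama argument. Instead of proving that Ext is finitely generated, one
iterates to get cycles `z = s 0, s 1, ...` with `s k` homotopic to `t s (k + 1)`, and assembles them
into one map from `M` to the product of countably many copies of `M`. The self-map `(u k) ↦ (u k - t
u (k + 1))` of that product is a quasi-isomorphism, because it is bijective on sequences in a
finitely generated module over the noetherian `t`-adically complete ring `R`
(`isQuasiIso_subShift`). It sends the assembled map to a boundary, so the assembled map is a
boundary, and its component at `0` shows that `z` is one.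

Finally `M` is itself semi-free, so any resolution `Q` of `M` is homotopy equivalent to `M` and
gives the same vanishing. -/

noncomputable section

/-! ### Signs and the twist of a graded algebra -/

namespace DG

theorem smul_units_smul {A N : Type*} [Ring A] [AddCommGroup N] [Module A N] (a : A) (u : ℤˣ)
    (x : N) : a • u • x = u • a • x := by
  rcases Int.units_eq_one_or u with rfl | rfl <;> simp only [one_smul, Units.neg_smul, smul_neg]

theorem units_smul_smul {A N : Type*} [Ring A] [AddCommGroup N] [Module A N] (a : A) (u : ℤˣ)
    (x : N) : (u • a) • x = u • a • x := by
  rcases Int.units_eq_one_or u with rfl | rfl <;> simp only [one_smul, Units.neg_smul, neg_smul]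

theorem units_smul_mem {R M : Type*} [CommRing R] [AddCommGroup M] [Module R M]
    {S : Submodule R M} (u : ℤˣ) {x : M} (hx : x ∈ S) : u • x ∈ S := by
  rw [Units.smul_def]; exact zsmul_mem hx _

theorem units_smul_units_smul {M : Type*} [AddCommGroup M] (u : ℤˣ) (x : M) : u • u • x = x := by
  rcases Int.units_eq_one_or u with rfl | rfl <;> simp

end DG

namespace DGAlgebra

variable {R : Type u} [CommRing R] (A : DGAlgebra R)

/-- The map `a ↦ (-1)^{p|a|} a`. -/
def twist (p : ℤ) : A →ₗ[R] A := if Even p then LinearMap.id else DG.signMap A.gr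

theorem twist_apply (p : ℤ) {i : ℤ} {a : A} (ha : a ∈ A.gr i) :
    A.twist p a = (p * i).negOnePow • a := by
  unfold twist
  split_ifs with h
  · rw [Int.negOnePow_even _ (h.mul_right i), one_smul, LinearMap.id_apply]
  · rw [DG.signMap_apply _ ha]
    congr 1
    rcases Int.even_or_odd i with hi | hi
    · rw [Int.negOnePow_even _ hi, Int.negOnePow_even _ (hi.mul_left p)]
    · rw [Int.negOnePow_odd _ hi, Int.negOnePow_odd _ ((Int.not_even_iff_odd.1 h).mul hi)]

theorem twist_mem (p : ℤ) {i : ℤ} {a : A} (ha : a ∈ A.gr i) : A.twist p a ∈ A.gr i := by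
  rw [A.twist_apply p ha]; exact DG.units_smul_mem _ ha

theorem signMap_eq_twist (a : A) : DG.signMap A.gr a = A.twist 1 a := by
  rw [twist, if_neg (by decide)]

theorem twist_twist (p q : ℤ) (a : A) : A.twist p (A.twist q a) = A.twist (p + q) a := by
  induction a using DirectSum.Decomposition.inductionOn A.gr with
  | zero => simp
  | add m m' h h' => simp only [map_add, h, h']
  | homogeneous a =>
    rw [A.twist_apply _ a.2, DG.map_units_smul, A.twist_apply _ a.2, A.twist_apply _ a.2, smul_smul,
      add_mul, Int.negOnePow_add, mul_comm]

theorem twist_zero (a : A) : A.twist 0 a = a := by simp [twist]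

/-- Only the parity of `p` enters the sign. This identifies the twists by `p + 2` and `p`, and by
`-1` and `1`. -/
theorem twist_congr {p q : ℤ} (h : Even (p - q)) : A.twist p = A.twist q := by
  unfold twist
  rw [Int.even_sub] at h
  by_cases hp : Even p
  · rw [if_pos hp, if_pos (h.1 hp)]
  · rw [if_neg hp, if_neg (fun hq => hp (h.2 hq))]

theorem twist_mul (p : ℤ) (a b : A) : A.twist p (a * b) = A.twist p a * A.twist p b := by
  unfold twist
  split_ifs
  · rfl
  · exact A.signMap_mul a b

theorem twist_one (p : ℤ) : A.twist p 1 = 1 := by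
  rw [A.twist_apply p (SetLike.one_mem_graded A.gr)]; simp

theorem twist_d (p : ℤ) (a : A) : A.twist p (A.d a) = p.negOnePow • A.d (A.twist p a) := by
  induction a using DirectSum.Decomposition.inductionOn A.gr with
  | zero => simp
  | add m m' h h' => simp only [map_add, smul_add, h, h']
  | homogeneous a =>
    rw [A.twist_apply _ a.2, DG.map_units_smul, A.twist_apply _ (A.d_mem a.2), smul_smul, mul_sub,
      mul_one, Int.negOnePow_sub, mul_comm]

theorem Hom.map_twist {A B : DGAlgebra R} (f : Hom A B) (p : ℤ) (a : A) :
    B.twist p (f.toAlgHom a) = f.toAlgHom (A.twist p a) := by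
  unfold twist
  split_ifs
  · rfl
  · exact DGModule.map_signMap f a

end DGAlgebra

/-! ### Cycles, homotopies and semi-bases -/

/-- A DG module over `A` whose homogeneous parts are not required to decompose it. This makes room
for full products. -/
structure PreDGModule {R : Type u} [CommRing R] (A : DGAlgebra R) where
  carrier : Type u
  [addCommGroup : AddCommGroup carrier]
  [moduleR : Module R carrier]
  [moduleA : Module A carrier]
  [tower : IsScalarTower R A carrier]
  gr : ℤ → Submodule R carrier
  smul_mem : ∀ {i j a m}, a ∈ A.gr i → m ∈ gr j → (a • m : carrier) ∈ gr (i + j)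
  d : carrier →ₗ[R] carrier
  d_mem : ∀ {i m}, m ∈ gr i → d m ∈ gr (i - 1)
  d_d : ∀ m, d (d m) = 0
  leibniz : ∀ (a : A) m, d (a • m) = A.d a • m + A.twist 1 a • d m

namespace PreDGModule

variable {R : Type u} [CommRing R] {A : DGAlgebra R}

instance : CoeSort (PreDGModule A) (Type u) := ⟨carrier⟩

instance (M : PreDGModule A) : AddCommGroup M := M.addCommGroup
instance (M : PreDGModule A) : Module R M := M.moduleR
instance (M : PreDGModule A) : Module A M := M.moduleA
instance (M : PreDGModule A) : IsScalarTower R A M := M.tower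

theorem d_units_smul (M : PreDGModule A) (u : ℤˣ) (m : M) : M.d (u • m) = u • M.d m :=
  DG.map_units_smul _ _ _

variable {L M N P : PreDGModule A}

/-- `R`-linear maps that are `A`-linear up to the sign of degree `p`. -/
def IsTwisted (p : ℤ) (f : M →ₗ[R] N) : Prop := ∀ (a : A) m, f (a • m) = A.twist p a • f m

/-- Maps of degree `p`. -/
def HasDegree (p : ℤ) (f : M →ₗ[R] N) : Prop := ∀ i, ∀ m ∈ M.gr i, f m ∈ N.gr (i + p)

/-- Cycles of degree `p` in the complex of homomorphisms. -/
structure IsCycle (p : ℤ) (f : M →ₗ[R] N) : Prop where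
  hasDegree : HasDegree p f
  isTwisted : IsTwisted p f
  d_apply : ∀ m, N.d (f m) = p.negOnePow • f (M.d m)

/-- `h` exhibits `f` as a boundary of degree `p` in the complex of homomorphisms. -/
structure IsHomotopy (p : ℤ) (h f : M →ₗ[R] N) : Prop where
  hasDegree : HasDegree (p + 1) h
  isTwisted : IsTwisted (p + 1) h
  apply_eq : ∀ m, f m = N.d (h m) + p.negOnePow • h (M.d m)

/-- Boundaries of degree `p` in the complex of homomorphisms. -/
def IsNull (p : ℤ) (f : M →ₗ[R] N) : Prop := ∃ h, IsHomotopy p h f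

theorem IsTwisted.comp {p q : ℤ} {f : N →ₗ[R] P} {g : M →ₗ[R] N} (hf : IsTwisted p f)
    (hg : IsTwisted q g) : IsTwisted (p + q) (f ∘ₗ g) := fun a m => by
  rw [LinearMap.comp_apply, hg, hf, A.twist_twist]; rfl

theorem HasDegree.comp {p q : ℤ} {f : N →ₗ[R] P} {g : M →ₗ[R] N} (hf : HasDegree p f)
    (hg : HasDegree q g) : HasDegree (p + q) (f ∘ₗ g) := fun i m hm => by
  rw [add_comm p, ← add_assoc]; exact hf _ _ (hg _ _ hm)

theorem IsCycle.comp {p q : ℤ} {f : N →ₗ[R] P} {g : M →ₗ[R] N} (hf : IsCycle p f)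
    (hg : IsCycle q g) : IsCycle (p + q) (f ∘ₗ g) :=
  ⟨hf.1.comp hg.1, hf.2.comp hg.2, fun m => by
    simp only [LinearMap.comp_apply]
    rw [hf.3, hg.3, DG.map_units_smul, smul_smul, Int.negOnePow_add]⟩

theorem IsTwisted.sub {p : ℤ} {f g : M →ₗ[R] N} (hf : IsTwisted p f) (hg : IsTwisted p g) :
    IsTwisted p (f - g) := fun a m => by
  rw [LinearMap.sub_apply, LinearMap.sub_apply, hf, hg, smul_sub]

theorem IsTwisted.units_smul {p : ℤ} {f : M →ₗ[R] N} (hf : IsTwisted p f) (u : ℤˣ) :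
    IsTwisted p (u • f) := fun a m => by
  rw [LinearMap.smul_apply, LinearMap.smul_apply, hf, DG.smul_units_smul]

theorem HasDegree.sub {p : ℤ} {f g : M →ₗ[R] N} (hf : HasDegree p f) (hg : HasDegree p g) :
    HasDegree p (f - g) := fun i m hm => sub_mem (hf i m hm) (hg i m hm)

theorem HasDegree.units_smul {p : ℤ} {f : M →ₗ[R] N} (hf : HasDegree p f) (u : ℤˣ) :
    HasDegree p (u • f) := fun i m hm => DG.units_smul_mem _ (hf i m hm)

theorem IsCycle.sub {p : ℤ} {f g : M →ₗ[R] N} (hf : IsCycle p f) (hg : IsCycle p g) :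
    IsCycle p (f - g) :=
  ⟨hf.1.sub hg.1, hf.2.sub hg.2, fun m => by
    rw [LinearMap.sub_apply, map_sub, hf.3, hg.3, LinearMap.sub_apply, smul_sub]⟩

theorem IsNull.add {p : ℤ} {f g : M →ₗ[R] N} : IsNull p f → IsNull p g → IsNull p (f + g) :=
  fun ⟨h, hh⟩ ⟨k, hk⟩ => ⟨h + k, fun i m hm => add_mem (hh.1 i m hm) (hk.1 i m hm),
    fun a m => by rw [LinearMap.add_apply, LinearMap.add_apply, hh.2, hk.2, smul_add],
    fun m => by simp only [LinearMap.add_apply, hh.3, hk.3, map_add, smul_add]; abel⟩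

theorem IsNull.of_sub {p : ℤ} {f g : M →ₗ[R] N} (hfg : IsNull p (f - g)) (hg : IsNull p g) :
    IsNull p f := by
  simpa using hfg.add hg

theorem isCycle_id (M : PreDGModule A) : IsCycle 0 (LinearMap.id : M →ₗ[R] M) :=
  ⟨fun i m hm => by rwa [add_zero], fun a m => by rw [A.twist_zero]; rfl, fun m => by simp⟩

theorem IsHomotopy.comp {p : ℤ} {f h : M →ₗ[R] N} (hf : IsHomotopy p h f) {g : L →ₗ[R] M}
    (hg : IsCycle 0 g) : IsHomotopy p (h ∘ₗ g) (f ∘ₗ g) :=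
  ⟨by simpa using hf.1.comp hg.1, by simpa using hf.2.comp hg.2, fun m => by
    have := hg.3 m
    simp only [Int.negOnePow_zero, one_smul] at this
    simp only [LinearMap.comp_apply, hf.3, this]⟩

theorem IsNull.comp {p : ℤ} {f : M →ₗ[R] N} (hf : IsNull p f) {g : L →ₗ[R] M}
    (hg : IsCycle 0 g) : IsNull p (f ∘ₗ g) :=
  let ⟨_, h⟩ := hf; ⟨_, h.comp hg⟩

theorem IsNull.postcomp {p q : ℤ} {f : M →ₗ[R] N} (hf : IsNull q f) {g : N →ₗ[R] P}
    (hg : IsCycle p g) : IsNull (p + q) (g ∘ₗ f) := by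
  obtain ⟨h, hh⟩ := hf
  -- The sign is the cost of moving the differential past `g`, which has degree `p`.
  refine ⟨p.negOnePow • (g ∘ₗ h), ?_, ?_, fun m => ?_⟩
  · rw [add_assoc]; exact (hg.1.comp hh.1).units_smul _
  · rw [add_assoc]; exact (hg.2.comp hh.2).units_smul _
  · simp only [LinearMap.comp_apply, LinearMap.smul_apply]
    rw [P.d_units_smul, hg.3, DG.units_smul_units_smul, hh.3, map_add, DG.map_units_smul,
      Int.negOnePow_add, smul_smul, mul_right_comm, Int.units_mul_self, one_mul]

/-- A family of homogeneous generators, bounded below, with respect to which the homogeneous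
elements have homogeneous coordinates. -/
structure SemiBasis (M : PreDGModule A) where
  E : Type u
  basis : Module.Basis E A M
  deg : E → ℤ
  bound : ℤ
  bound_le : ∀ e, bound ≤ deg e
  basis_mem : ∀ e, basis e ∈ M.gr (deg e)
  repr_mem : ∀ {i m}, m ∈ M.gr i → ∀ e, basis.repr m e ∈ A.gr (i - deg e)

namespace SemiBasis

variable (b : SemiBasis M)

/-- The twisted linear map with given values on the basis. -/
def extend (p : ℤ) (v : b.E → N) : M →ₗ[R] N :=
  Finsupp.lsum R (fun e => (LinearMap.toSpanSingleton A N (v e)).restrictScalars R ∘ₗ A.twist p) ∘ₗ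
    b.basis.repr.toLinearMap.restrictScalars R

theorem extend_apply (p : ℤ) (v : b.E → N) (m : M) :
    b.extend p v m = (b.basis.repr m).sum fun e a => A.twist p a • v e := rfl

theorem extend_basis (p : ℤ) (v : b.E → N) (e : b.E) : b.extend p v (b.basis e) = v e := by
  rw [extend_apply, Module.Basis.repr_self, Finsupp.sum_single_index] <;> simp [A.twist_one]

theorem isTwisted_extend (p : ℤ) (v : b.E → N) : IsTwisted p (b.extend p v) := fun a m => by
  rw [extend_apply, extend_apply, map_smul, Finsupp.sum_smul_index' (by simp), Finsupp.smul_sum]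
  refine Finsupp.sum_congr fun e _ => ?_
  rw [smul_eq_mul, A.twist_mul, mul_smul]

theorem extend_mem {p i : ℤ} {v : b.E → N} {m : M} (hm : m ∈ M.gr i)
    (hv : ∀ e, b.basis.repr m e ≠ 0 → v e ∈ N.gr (b.deg e + p)) :
    b.extend p v m ∈ N.gr (i + p) := by
  refine Submodule.sum_mem _ fun e he => ?_
  have := N.smul_mem (A.twist_mem p (b.repr_mem hm e)) (hv e (Finsupp.mem_support_iff.1 he))
  rwa [show i - b.deg e + (b.deg e + p) = i + p by ring] at this

theorem deg_le {i : ℤ} {m : M} (hm : m ∈ M.gr i) {e : b.E} (he : b.basis.repr m e ≠ 0) :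
    b.deg e ≤ i := by
  by_contra h
  refine he ?_
  have := b.repr_mem hm e
  rwa [A.gr_neg _ (by omega), Submodule.mem_bot] at this

theorem extend_congr (p : ℤ) {v v' : b.E → N} {m : M}
    (hv : ∀ e, b.basis.repr m e ≠ 0 → v e = v' e) : b.extend p v m = b.extend p v' m := by
  rw [extend_apply, extend_apply]
  exact Finsupp.sum_congr fun e he => by rw [hv e (Finsupp.mem_support_iff.1 he)]

/-- A twisted map vanishes at an element if it vanishes at the basis elements occurring in it. -/
theorem apply_eq_zero {p : ℤ} {f : M →ₗ[R] N} (hf : IsTwisted p f) {m : M}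
    (h : ∀ e, b.basis.repr m e ≠ 0 → f (b.basis e) = 0) : f m = 0 := by
  conv_lhs => rw [← b.basis.linearCombination_repr m, Finsupp.linearCombination_apply, Finsupp.sum,
    map_sum]
  exact Finset.sum_eq_zero fun e he => by rw [hf, h e (Finsupp.mem_support_iff.1 he), smul_zero]

end SemiBasis

/-- The differential of the complex of homomorphisms preserves twisted linearity. -/
theorem IsTwisted.dHom {p : ℤ} {f : M →ₗ[R] N} (hf : IsTwisted (p + 1) f) :
    IsTwisted p (N.d ∘ₗ f + p.negOnePow • (f ∘ₗ M.d)) := fun a m => by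
  simp only [LinearMap.add_apply, LinearMap.comp_apply, LinearMap.smul_apply]
  -- The two terms containing `A.d a` cancel by `twist_d`; the remaining ones carry the twist by `p
  -- + 2`, which is the twist by `p`.
  rw [hf, N.leibniz, M.leibniz, map_add, hf, hf, A.twist_twist, A.twist_twist, A.twist_d,
    DG.units_smul_smul, A.twist_congr (show Even (1 + (p + 1) - p) from ⟨1, by ring⟩),
    A.twist_congr (show Even (p + 1 + 1 - p) from ⟨1, by ring⟩), Int.negOnePow_succ]
  simp only [smul_add, DG.smul_units_smul, smul_smul, Units.neg_smul, smul_neg, Int.units_mul_self,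
    one_smul]
  abel

end PreDGModule

/-! ### Lifting maps out of semi-free modules through quasi-isomorphisms -/

/-- Simultaneous choice along a rank function: a choice at `e` may depend on the choices made at
elements of smaller rank. -/
theorem exists_forall_of_rank {E C : Type*} [Nonempty C] (rk : E → ℕ)
    (Q : E → (E → C) → C → Prop)
    (hloc : ∀ e v v' c, (∀ e', rk e' < rk e → v e' = v' e') → Q e v c → Q e v' c)
    (hex : ∀ e v, (∀ e', rk e' < rk e → Q e' v (v e')) → ∃ c, Q e v c) :
    ∃ v : E → C, ∀ e, Q e v (v e) := by
  classical
  -- The value at `e` is chosen before earlier choices are known to be correct, hence `epsilon`;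
  -- correctness follows afterwards by induction on the rank. The default value at elements of
  -- larger or equal rank is harmless by `hloc`.
  let F : ∀ e : E, (∀ e', rk e' < rk e → C) → C := fun e rec =>
    Classical.epsilon (Q e fun e' => if h : rk e' < rk e then rec e' h else Classical.arbitrary C)
  let v : E → C := (measure rk).wf.fix F
  have hv : ∀ e, v e = Classical.epsilon
      (Q e fun e' => if rk e' < rk e then v e' else Classical.arbitrary C) := fun e => by
    change (measure rk).wf.fix F e = _
    rw [WellFounded.fix_eq]
    rfl
  refine ⟨v, fun e => ?_⟩
  induction hn : rk e using Nat.strong_induction_on generalizing e with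
  | _ n ih =>
    obtain ⟨c, hc⟩ := hex e v fun e' he' => ih _ (hn ▸ he') e' rfl
    have h : Q e (fun e' => if rk e' < rk e then v e' else Classical.arbitrary C) c :=
      hloc e v _ c (fun e' he' => (if_pos he').symm) hc
    have := Classical.epsilon_spec (p := Q e _) ⟨c, h⟩
    rw [← hv] at this
    exact hloc e _ v _ (fun e' he' => if_pos he') this

namespace PreDGModule

variable {R : Type u} [CommRing R] {A : DGAlgebra R} {L M N P N' : PreDGModule A}

/-- Morphisms inducing bijections in homology. -/
structure IsQuasiIso (g : N →ₗ[R] N') : Prop where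
  isCycle : IsCycle 0 g
  inj : ∀ {i z y}, z ∈ N.gr i → N.d z = 0 → y ∈ N'.gr (i + 1) → N'.d y = g z →
    ∃ w ∈ N.gr (i + 1), N.d w = z
  surj : ∀ {i y}, y ∈ N'.gr i → N'.d y = 0 →
    ∃ u ∈ N.gr i, N.d u = 0 ∧ ∃ v ∈ N'.gr (i + 1), y = g u + N'.d v

theorem IsCycle.apply_d {g : N →ₗ[R] N'} (hg : IsCycle 0 g) (x : N) :
    N'.d (g x) = g (N.d x) := by
  simpa using hg.3 x

theorem IsCycle.apply_mem {g : N →ₗ[R] N'} (hg : IsCycle 0 g) {i : ℤ} {x : N} (hx : x ∈ N.gr i) :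
    g x ∈ N'.gr i := by
  simpa using hg.1 i x hx

/-- Acyclicity of the mapping cone of a quasi-isomorphism. -/
theorem IsQuasiIso.exists_eq {g : N →ₗ[R] N'} (hg : IsQuasiIso g) {i : ℤ} {z : N} {y : N'}
    (hz : z ∈ N.gr i) (hdz : N.d z = 0) (hy : y ∈ N'.gr (i + 1)) (h : N'.d y = g z) :
    ∃ w ∈ N.gr (i + 1), N.d w = z ∧ ∃ v ∈ N'.gr (i + 1 + 1), N'.d v = y - g w := by
  obtain ⟨w, hw, rfl⟩ := hg.inj hz hdz hy h
  -- The difference `y - g w` is only a cycle. Its class comes from a cycle `u`, and replacing `w`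
  -- by `w + u` turns it into a boundary without changing `N.d w`.
  obtain ⟨u, hu, hdu, v, hv, e⟩ := hg.surj (sub_mem hy (hg.isCycle.apply_mem hw))
    (by rw [map_sub, h, hg.isCycle.apply_d, sub_self])
  refine ⟨w + u, add_mem hw hu, by rw [map_add, hdu, add_zero], v, hv, ?_⟩
  rw [map_add, ← sub_sub, e, add_sub_cancel_left]

/-- The pair `(φ, h)` is a cycle in the complex of maps from `M` to the mapping cone of `g`. The
cone is acyclic, so on a semi-free `M` a bounding pair `(ψ, k)` can be built one basis element at a
time, by induction on the degree. This single statement contains both halves of the fact that `g`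
induces isomorphisms on the homology of `Hom(M, -)`: injectivity by forgetting `k`, surjectivity by
taking `φ = 0`. -/
theorem SemiBasis.exists_lift (b : SemiBasis M) {g : N →ₗ[R] N'} (hg : IsQuasiIso g) {p : ℤ}
    {φ : M →ₗ[R] N} (hφ : IsCycle p φ) {h : M →ₗ[R] N'} (hh : IsHomotopy p h (g ∘ₗ φ)) :
    ∃ ψ, IsHomotopy p ψ φ ∧ IsNull (p + 1) (h - g ∘ₗ ψ) := by
  -- The components of `c` are the candidate values of `ψ` and `k` at the basis element `e`. The
  -- conditions are the two homotopy identities at `e`, solved for the differentials of these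
  -- values; `v` supplies the values on `M.d (b.basis e)`.
  let Q : b.E → (b.E → N × N') → N × N' → Prop := fun e v c =>
    c.1 ∈ N.gr (b.deg e + (p + 1)) ∧ c.2 ∈ N'.gr (b.deg e + (p + 1 + 1)) ∧
    N.d c.1 = φ (b.basis e) -
      p.negOnePow • b.extend (p + 1) (fun e => (v e).1) (M.d (b.basis e)) ∧
    N'.d c.2 = h (b.basis e) - g c.1 +
      p.negOnePow • b.extend (p + 1 + 1) (fun e => (v e).2) (M.d (b.basis e))
  -- Since `A` vanishes in negative degrees, the differential of a basis element involves only basis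
  -- elements of strictly smaller degree.
  have hrk : ∀ e e', b.basis.repr (M.d (b.basis e)) e' ≠ 0 → b.deg e' < b.deg e := fun e e' h => by
    have := b.deg_le (M.d_mem (b.basis_mem e)) h
    omega
  have hrk' : ∀ e e', b.deg e' < b.deg e ↔
      (b.deg e' - b.bound).toNat < (b.deg e - b.bound).toNat := fun e e' => by
    have := b.bound_le e
    have := b.bound_le e'
    omega
  -- Both sides of each identity are twisted of the same degree, so an identity holds at `m` once it
  -- holds at the basis elements occurring in `m`. It is needed for `m = M.d (b.basis e)` during the
  -- induction and for all `m` at the end.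
  have key : ∀ v : b.E → N × N', ∀ m, (∀ e, b.basis.repr m e ≠ 0 → Q e v (v e)) →
      φ m = N.d (b.extend (p + 1) (fun e => (v e).1) m) +
        p.negOnePow • b.extend (p + 1) (fun e => (v e).1) (M.d m) ∧
      (h - g ∘ₗ b.extend (p + 1) (fun e => (v e).1)) m =
        N'.d (b.extend (p + 1 + 1) (fun e => (v e).2) m) +
        (p + 1).negOnePow • b.extend (p + 1 + 1) (fun e => (v e).2) (M.d m) := by
    intro v m hv
    have hψ := b.isTwisted_extend (p + 1) fun e => (v e).1
    have hk := b.isTwisted_extend (p + 1 + 1) fun e => (v e).2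
    have hgψ := hg.isCycle.isTwisted.comp hψ
    rw [zero_add] at hgψ
    constructor
    · refine sub_eq_zero.1 (b.apply_eq_zero (hφ.isTwisted.sub hψ.dHom) fun e he => ?_)
      simp only [LinearMap.sub_apply, LinearMap.add_apply, LinearMap.comp_apply,
        LinearMap.smul_apply, b.extend_basis]
      rw [(hv e he).2.2.1]
      abel
    · refine sub_eq_zero.1 (b.apply_eq_zero ((hh.isTwisted.sub hgψ).sub hk.dHom) fun e he => ?_)
      simp only [LinearMap.sub_apply, LinearMap.add_apply, LinearMap.comp_apply,
        LinearMap.smul_apply, b.extend_basis]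
      rw [(hv e he).2.2.2, Int.negOnePow_succ, Units.neg_smul]
      abel
  obtain ⟨v, hv⟩ := exists_forall_of_rank (fun e => (b.deg e - b.bound).toNat) Q
    (by
      intro e v v' c hvv' ⟨h1, h2, h3, h4⟩
      refine ⟨h1, h2, ?_, ?_⟩
      · rw [h3]
        congr 2
        exact b.extend_congr _ fun e' he' => by rw [hvv' e' ((hrk' _ _).1 (hrk e e' he'))]
      · rw [h4]
        congr 2
        exact b.extend_congr _ fun e' he' => by rw [hvv' e' ((hrk' _ _).1 (hrk e e' he'))])
    (by
      intro e v hv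
      replace hv : ∀ e', b.basis.repr (M.d (b.basis e)) e' ≠ 0 → Q e' v (v e') :=
        fun e' he' => hv e' ((hrk' _ _).1 (hrk e e' he'))
      obtain ⟨k1, k2⟩ := key v _ hv
      have m1 := b.extend_mem (M.d_mem (b.basis_mem e)) fun e' he' => (hv e' he').1
      have m2 := b.extend_mem (M.d_mem (b.basis_mem e)) fun e' he' => (hv e' he').2.1
      rw [show b.deg e - 1 + (p + 1) = b.deg e + p by ring] at m1
      rw [show b.deg e - 1 + (p + 1 + 1) = b.deg e + p + 1 by ring] at m2
      simp only [M.d_d, map_zero, smul_zero, add_zero, LinearMap.sub_apply,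
        LinearMap.comp_apply] at k1 k2
      have h1 := hφ.3 (b.basis e)
      have h2 := hh.3 (b.basis e)
      have h3 := hh.1 _ _ (b.basis_mem e)
      rw [← add_assoc] at h3
      -- The identities at `M.d (b.basis e)`, together with `d² = 0`, say precisely that the
      -- required values of the differentials form a cycle of the cone.
      obtain ⟨w, hw, hdw, y, hy, hdy⟩ := hg.exists_eq
        (sub_mem (hφ.1 _ _ (b.basis_mem e)) (DG.units_smul_mem p.negOnePow m1))
        (by rw [map_sub, N.d_units_smul, ← k1, h1, sub_self])
        (add_mem h3 (DG.units_smul_mem p.negOnePow m2))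
        (by
          rw [LinearMap.comp_apply] at h2
          rw [map_add, N'.d_units_smul, ← k2, map_sub, h2, DG.map_units_smul, smul_sub]
          abel)
      refine ⟨(w, y), by rwa [← add_assoc], by rwa [← add_assoc, ← add_assoc], hdw, ?_⟩
      rw [hdy]
      abel)
  refine ⟨b.extend (p + 1) fun e => (v e).1, ⟨fun i m hm => ?_, b.isTwisted_extend _ _,
    fun m => (key v m fun e _ => hv e).1⟩, b.extend (p + 1 + 1) fun e => (v e).2,
    fun i m hm => ?_, b.isTwisted_extend _ _, fun m => (key v m fun e _ => hv e).2⟩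
  · exact b.extend_mem hm fun e _ => (hv e).1
  · exact b.extend_mem hm fun e _ => (hv e).2.1

/-- Viewing cycles as homotopies of the zero map, here and in the converse below, makes the lifting
of cycles a special case of `SemiBasis.exists_lift`. -/
theorem isHomotopy_zero {p : ℤ} {h : M →ₗ[R] N} (hh : IsCycle (p + 1) h) :
    IsHomotopy p h (0 : M →ₗ[R] N) :=
  ⟨hh.1, hh.2, fun m => by
    rw [hh.3, Int.negOnePow_succ, Units.neg_smul, neg_add_cancel, LinearMap.zero_apply]⟩

theorem isCycle_of_isHomotopy_zero {p : ℤ} {h : M →ₗ[R] N}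
    (hh : IsHomotopy p h (0 : M →ₗ[R] N)) : IsCycle (p + 1) h :=
  ⟨hh.1, hh.2, fun m => by
    rw [eq_neg_of_add_eq_zero_left (hh.3 m).symm, Int.negOnePow_succ, Units.neg_smul]⟩

theorem isCycle_zero (p : ℤ) : IsCycle p (0 : M →ₗ[R] N) :=
  ⟨fun _ _ _ => zero_mem _, fun _ _ => by simp, fun _ => by simp⟩

/-- Lifting along a quasi-isomorphism, up to homotopy. -/
theorem SemiBasis.exists_lift_cycle (b : SemiBasis M) {g : N →ₗ[R] N'} (hg : IsQuasiIso g) {p : ℤ}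
    {h : M →ₗ[R] N'} (hh : IsCycle p h) :
    ∃ ψ : M →ₗ[R] N, IsCycle p ψ ∧ IsNull p (h - g ∘ₗ ψ) := by
  obtain ⟨q, rfl⟩ : ∃ q, p = q + 1 := ⟨p - 1, by ring⟩
  obtain ⟨ψ, h1, h2⟩ := b.exists_lift hg (isCycle_zero q)
    (by rw [LinearMap.comp_zero]; exact isHomotopy_zero hh)
  exact ⟨ψ, isCycle_of_isHomotopy_zero h1, h2⟩

theorem SemiBasis.isNull_of_comp (b : SemiBasis M) {g : N →ₗ[R] N'} (hg : IsQuasiIso g) {p : ℤ}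
    {φ : M →ₗ[R] N} (hφ : IsCycle p φ) (h : IsNull p (g ∘ₗ φ)) : IsNull p φ := by
  obtain ⟨k, hk⟩ := h
  obtain ⟨ψ, hψ, -⟩ := b.exists_lift hg hφ hk
  exact ⟨ψ, hψ⟩

/-- Quasi-isomorphisms are invariant under homotopy. -/
theorem IsQuasiIso.of_homotopic {f g : N →ₗ[R] N'} (hf : IsQuasiIso f) (hg : IsCycle 0 g)
    (h : IsNull 0 (f - g)) : IsQuasiIso g := by
  obtain ⟨k, hk⟩ := h
  have e : ∀ z, N.d z = 0 → f z = g z + N'.d (k z) := fun z hz => by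
    have := hk.3 z
    rw [hz, map_zero, smul_zero, add_zero, LinearMap.sub_apply] at this
    rw [← this]; abel
  have hkm : ∀ {i z}, z ∈ N.gr i → k z ∈ N'.gr (i + 1) := fun hz => by simpa using hk.1 _ _ hz
  refine ⟨hg, fun {i z y} hz hdz hy h => ?_, fun {i y} hy hdy => ?_⟩
  · exact hf.inj hz hdz (add_mem hy (hkm hz)) (by rw [map_add, h, e z hdz])
  · obtain ⟨u, hu, hdu, v, hv, rfl⟩ := hf.surj hy hdy
    refine ⟨u, hu, hdu, v + k u, add_mem hv (hkm hu), ?_⟩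
    rw [e u hdu, map_add]; abel

theorem IsQuasiIso.comp {g : N →ₗ[R] P} {f : M →ₗ[R] N} (hg : IsQuasiIso g) (hf : IsQuasiIso f) :
    IsQuasiIso (g ∘ₗ f) := by
  refine ⟨by simpa using hg.isCycle.comp hf.isCycle, fun {i z y} hz hdz hy h => ?_,
    fun {i y} hy hdy => ?_⟩
  · obtain ⟨w, hw, hdw⟩ := hg.inj (hf.isCycle.apply_mem hz)
      (by rw [hf.isCycle.apply_d, hdz, map_zero]) hy h
    exact hf.inj hz hdz hw hdw
  · obtain ⟨u, hu, hdu, v, hv, rfl⟩ := hg.surj hy hdy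
    obtain ⟨u', hu', hdu', v', hv', rfl⟩ := hf.surj hu hdu
    refine ⟨u', hu', hdu', v + g v', add_mem hv (hg.isCycle.apply_mem hv'), ?_⟩
    rw [map_add, map_add, hg.isCycle.apply_d, LinearMap.comp_apply]
    abel

theorem IsQuasiIso.of_comp {g : N →ₗ[R] P} {f : M →ₗ[R] N} (hf : IsCycle 0 f) (hg : IsQuasiIso g)
    (h : IsQuasiIso (g ∘ₗ f)) : IsQuasiIso f := by
  refine ⟨hf, fun {i z y} hz hdz hy e => ?_, fun {i y} hy hdy => ?_⟩
  · exact h.inj hz hdz (hg.isCycle.apply_mem hy)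
      (by rw [hg.isCycle.apply_d, e, LinearMap.comp_apply])
  · obtain ⟨u, hu, hdu, v, hv, e⟩ := h.surj (hg.isCycle.apply_mem hy)
      (by rw [hg.isCycle.apply_d, hdy, map_zero])
    obtain ⟨w, hw, hdw⟩ := hg.inj (sub_mem hy (hf.apply_mem hu))
      (by rw [map_sub, hdy, hf.apply_d, hdu, map_zero, sub_zero]) hv
      (by rw [map_sub, e, LinearMap.comp_apply]; abel)
    exact ⟨u, hu, hdu, w, hw, by rw [hdw]; abel⟩

/-- A quasi-isomorphism between semi-free modules may be cancelled on the right up to homotopy. -/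
theorem SemiBasis.isNull_of_forall_isNull (bL : SemiBasis L) (bM : SemiBasis M) {π : L →ₗ[R] M}
    (hπ : IsQuasiIso π) {p : ℤ} (h : ∀ φ : M →ₗ[R] N, IsCycle p φ → IsNull p φ)
    {φ : L →ₗ[R] N} (hφ : IsCycle p φ) : IsNull p φ := by
  obtain ⟨σ, hσ, hπσ⟩ := bM.exists_lift_cycle hπ (isCycle_id M)
  have h0 : IsCycle 0 (σ ∘ₗ π) := by simpa using hσ.comp hπ.isCycle
  -- The right homotopy inverse `σ` is also a left one: `π (id - σ π) = (id - π σ) π` is null, and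
  -- `π` can be cancelled on the left because `L` is semi-free.
  have h1 : IsNull 0 (LinearMap.id - σ ∘ₗ π) := by
    refine bL.isNull_of_comp hπ ((isCycle_id L).sub h0) ?_
    convert hπσ.comp hπ.isCycle using 1
    ext x; simp
  have h2 := h1.postcomp hφ
  rw [add_zero, LinearMap.comp_sub, LinearMap.comp_id] at h2
  exact h2.of_sub ((h (φ ∘ₗ σ) (by simpa using hφ.comp hσ)).comp hπ.isCycle)

end PreDGModule

/-! ### Ext vanishing and semi-freeness in terms of cycles, homotopies and semi-bases -/

namespace DGModule

variable {R : Type u} [CommRing R] {A : DGAlgebra R}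

/-- The underlying `PreDGModule` of a DG module. -/
abbrev toPre (M : DGModule A) : PreDGModule A where
  carrier := M.carrier
  gr := M.gr
  smul_mem := M.smul_mem
  d := M.d
  d_mem := M.d_mem
  d_d := M.d_d
  leibniz a m := by rw [M.leibniz', A.signMap_eq_twist]

variable {M N : DGModule A}

theorem isTwisted_iff {p : ℤ} {f : M →ₗ[R] N} :
    PreDGModule.IsTwisted (M := M.toPre) (N := N.toPre) p f ↔
      ∀ i, ∀ a ∈ A.gr i, ∀ m : M, f (a • m) = (p * i).negOnePow • (a • f m) := by
  refine ⟨fun h i a ha m => ?_, fun h a m => ?_⟩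
  · rw [← DG.units_smul_smul, ← A.twist_apply p ha]; exact h a m
  · induction a using DirectSum.Decomposition.inductionOn A.gr with
    | zero => simp
    | add a b ha hb => simp only [add_smul, map_add, ha, hb]
    | homogeneous a => rw [A.twist_apply p a.2, DG.units_smul_smul]; exact h _ _ a.2 m

theorem subsingleton_homHomology_iff {p : ℤ} : Subsingleton (homHomology M N p) ↔
    ∀ f : M.toPre →ₗ[R] N.toPre, PreDGModule.IsCycle p f → PreDGModule.IsNull p f := by
  rw [Submodule.Quotient.subsingleton_iff]
  constructor
  · intro h f hf
    have hf' : f ∈ homCycles M N p :=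
      ⟨⟨hf.1, isTwisted_iff.1 hf.2⟩, LinearMap.mem_ker.2 (LinearMap.ext fun m => by
        rw [homD_apply, LinearMap.zero_apply, sub_eq_zero]; exact hf.3 m)⟩
    obtain ⟨k, ⟨hk, hk'⟩, e⟩ : f ∈ homBoundaries M N p := by
      have : (⟨f, hf'⟩ : homCycles M N p) ∈ (homBoundaries M N p).submoduleOf _ := by
        rw [h]; trivial
      exact this
    refine ⟨k, hk, isTwisted_iff.2 hk', fun m => ?_⟩
    rw [← e, homD_apply, Int.negOnePow_succ, Units.neg_smul, sub_neg_eq_add]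
  · intro h
    rw [eq_top_iff]
    rintro ⟨f, ⟨hf, hf'⟩, hd⟩ -
    obtain ⟨k, hk⟩ := h f ⟨hf, isTwisted_iff.2 hf', fun m => by
      have := LinearMap.congr_fun (LinearMap.mem_ker.1 hd) m
      rw [homD_apply, LinearMap.zero_apply, sub_eq_zero] at this
      exact this⟩
    refine ⟨k, ⟨hk.1, isTwisted_iff.1 hk.2⟩, LinearMap.ext fun m => ?_⟩
    rw [homD_apply, Int.negOnePow_succ, Units.neg_smul, sub_neg_eq_add]
    exact (hk.3 m).symm

theorem Hom.isCycle (f : Hom M N) : PreDGModule.IsCycle (M := M.toPre) (N := N.toPre) 0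
    (f.toLinearMap.restrictScalars R) :=
  ⟨fun i m hm => by rw [add_zero]; exact f.map_gr hm,
    fun a m => by rw [A.twist_zero]; exact f.toLinearMap.map_smul a m,
    fun m => by rw [Int.negOnePow_zero, one_smul]; exact (f.map_d m).symm⟩

theorem Hom.IsQuasiIso.toPre {f : Hom M N} (hf : f.IsQuasiIso) :
    PreDGModule.IsQuasiIso (N := M.toPre) (N' := N.toPre) (f.toLinearMap.restrictScalars R) := by
  refine ⟨f.isCycle, fun {i z y} hz hdz hy h => ?_, fun {i y} hy hdy => ?_⟩
  · have h0 : f.homologyMap i (Submodule.Quotient.mk ⟨z, hz, hdz⟩) = 0 :=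
      (Submodule.Quotient.mk_eq_zero _).2 ⟨y, hy, h⟩
    rw [← map_zero (f.homologyMap i)] at h0
    exact (Submodule.Quotient.mk_eq_zero _).1 ((hf i).1 h0)
  · obtain ⟨x, hx⟩ := (hf i).2 (Submodule.Quotient.mk ⟨y, hy, hdy⟩)
    induction x using Submodule.Quotient.induction_on with
    | H x =>
      obtain ⟨v, hv, e⟩ := (Submodule.Quotient.eq _).1 hx.symm
      refine ⟨x, x.2.1, x.2.2, v, hv, ?_⟩
      rw [show N.toPre.d v = N.d v from rfl, e]
      exact (add_sub_cancel _ _).symm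

/-- Coordinates commute with taking homogeneous components, up to the shift by `deg e`. By linearity
this is checked on homogeneous multiples of a single basis element. -/
theorem repr_mem_of_mem {E : Type*} (b : Module.Basis E A M) (deg : E → ℤ)
    (hb : ∀ e, b e ∈ M.gr (deg e)) {i : ℤ} {m : M} (hm : m ∈ M.gr i) (e : E) :
    b.repr m e ∈ A.gr (i - deg e) := by
  classical
  have key : ∀ m : M, b.repr (DirectSum.decompose M.gr m i : M) e =
      (DirectSum.decompose A.gr (b.repr m e) (i - deg e) : A) := by
    intro m
    obtain ⟨c, rfl⟩ := b.repr.symm.surjective m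
    induction c using Finsupp.induction_linear with
    | zero => simp
    | add x y hx hy =>
      simp only [map_add, DirectSum.decompose_add, DirectSum.add_apply, Submodule.coe_add,
        Finsupp.add_apply, hx, hy]
    | single e' a =>
      rw [LinearEquiv.apply_symm_apply, Module.Basis.repr_symm_single]
      induction a using DirectSum.Decomposition.inductionOn A.gr with
      | zero => simp
      | add x y hx hy =>
        simp only [add_smul, map_add, DirectSum.decompose_add, DirectSum.add_apply,
          Submodule.coe_add, Finsupp.add_apply, hx, hy, Finsupp.single_add]
      | homogeneous a =>
        rename_i j
        have hm := M.smul_mem a.2 (hb e')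
        rw [Finsupp.single_apply]
        by_cases hj : j + deg e' = i
        · rw [← hj, DirectSum.decompose_of_mem_same M.gr hm, map_smul, Module.Basis.repr_self,
            Finsupp.smul_single, Finsupp.single_apply, smul_eq_mul, mul_one]
          split_ifs with he
          · rw [he, add_sub_cancel_right, DirectSum.decompose_of_mem_same A.gr a.2]
          · simp
        · rw [DirectSum.decompose_of_mem_ne M.gr hm hj, map_zero, Finsupp.zero_apply]
          split_ifs with he
          · rw [DirectSum.decompose_of_mem_ne A.gr a.2 (by rw [← he]; omega)]
          · simp
  rw [← DirectSum.decompose_of_mem_same M.gr hm, key]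
  exact SetLike.coe_mem _

/-- A homogeneous basis of a semi-free DG module. -/
theorem IsSemifree.nonempty_semiBasis (h : M.IsSemifree) : Nonempty (M.toPre).SemiBasis := by
  obtain ⟨⟨n, hn⟩, E, b, hb⟩ := h
  choose deg hdeg using hb
  -- A basis element assigned a degree below `n` is zero, hence lies in every degree, so its degree
  -- may be raised to `n` to make degrees bounded below.
  have hb : ∀ e, b e ∈ M.gr (max (deg e) n) := fun e => by
    rcases lt_or_ge (deg e) n with h | h
    · have := hdeg e
      rw [hn _ h, Submodule.mem_bot] at this
      rw [this]
      exact zero_mem _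
    · rw [max_eq_left h]; exact hdeg e
  exact ⟨⟨E, b, fun e => max (deg e) n, n, fun e => le_max_right _ _, hb,
    fun hm e => repr_mem_of_mem b _ hb hm e⟩⟩

end DGModule

/-! ### Transfer along zigzags -/

namespace PreDGModule

variable {R : Type u} [CommRing R] {A : DGAlgebra R}

/-- Vanishing of the homology of `Hom(L, -)` propagates along zigzags of quasi-isomorphisms. -/
theorem SemiBasis.exists_quasiIso_of_quasiIsomorphic {L : PreDGModule A} (b : SemiBasis L) (p : ℤ)
    {X Y : DGModule A} (h : DGModule.QuasiIsomorphic X Y) :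
    ((∃ ρ : L →ₗ[R] X.toPre, IsQuasiIso ρ) ∧
        ∀ φ : L →ₗ[R] X.toPre, IsCycle p φ → IsNull p φ) ↔
      ((∃ ρ : L →ₗ[R] Y.toPre, IsQuasiIso ρ) ∧
        ∀ φ : L →ₗ[R] Y.toPre, IsCycle p φ → IsNull p φ) := by
  induction h with
  | refl => rfl
  | symm _ _ _ ih => exact ih.symm
  | trans _ _ _ _ _ ih ih' => exact ih.trans ih'
  | rel X Y h =>
    obtain ⟨f, hf⟩ := h
    replace hf := hf.toPre
    constructor
    · rintro ⟨⟨ρ, hρ⟩, h⟩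
      refine ⟨⟨_, hf.comp hρ⟩, fun φ hφ => ?_⟩
      -- A cycle into `Y` lifts to `X` up to homotopy, and the lift is null by assumption.
      obtain ⟨ψ, hψ, hn⟩ := b.exists_lift_cycle hf hφ
      have := (h ψ hψ).postcomp hf.isCycle
      rw [zero_add] at this
      exact hn.of_sub this
    · rintro ⟨⟨ρ, hρ⟩, h⟩
      refine ⟨?_, fun φ hφ => b.isNull_of_comp hf hφ
        (h _ (by simpa using hf.isCycle.comp hφ))⟩
      -- Against the direction of the arrow, `ρ` is lifted: `f ∘ σ` is homotopic to `ρ`, hence a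
      -- quasi-isomorphism, and so is `σ` by two out of three.
      obtain ⟨σ, hσ, hn⟩ := b.exists_lift_cycle hf hρ.isCycle
      exact ⟨σ, .of_comp hσ hf
        (hρ.of_homotopic (by simpa using hf.isCycle.comp hσ) hn)⟩

end PreDGModule

/-! ### Sequences in finite modules over an adically complete ring -/

section AdicSequences

variable {R : Type u} [CommRing R] {t : R}

/-- Take `U k = ∑ l, t ^ l * r (k + l)`, which converges `t`-adically; the equation is telescoping.
-/
theorem IsAdicComplete.exists_sub_mul_succ (hR : IsAdicComplete (Ideal.span {t}) R) (r : ℕ → R) :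
    ∃ U : ℕ → R, ∀ k, r k = U k - t * U (k + 1) := by
  have hex : ∀ k, ∃ L : R, ∀ n, t ^ n ∣ ∑ l ∈ Finset.range n, t ^ l * r (k + l) - L := by
    intro k
    obtain ⟨L, hL⟩ := hR.toIsPrecomplete.prec
      (f := fun n => ∑ l ∈ Finset.range n, t ^ l * r (k + l)) (by
        intro m n hmn
        rw [SModEq.sub_mem, smul_eq_mul, Ideal.mul_top, Ideal.span_singleton_pow,
          Ideal.mem_span_singleton, ← dvd_neg, neg_sub, ← Finset.sum_range_add_sum_Ico _ hmn,
          add_sub_cancel_left]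
        exact Finset.dvd_sum fun l hl =>
          (pow_dvd_pow t (Finset.mem_Ico.1 hl).1).mul_right _)
    refine ⟨L, fun n => ?_⟩
    have := hL n
    rwa [SModEq.sub_mem, smul_eq_mul, Ideal.mul_top, Ideal.span_singleton_pow,
      Ideal.mem_span_singleton] at this
  choose U hU using hex
  refine ⟨U, fun k => sub_eq_zero.1 (hR.toIsHausdorff.haus _ fun n => ?_)⟩
  rw [SModEq.zero, smul_eq_mul, Ideal.mul_top, Ideal.span_singleton_pow,
    Ideal.mem_span_singleton]
  -- The partial sum with `n + 1` terms at `k` is `r k` plus `t` times the partial sum with `n`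
  -- terms at `k + 1`, whence the different lengths.
  have h1 := (pow_dvd_pow t n.le_succ).trans (hU k (n + 1))
  have h2 := (hU (k + 1) n).mul_left t
  convert h1.sub h2 using 1
  rw [Finset.sum_range_succ', mul_sub, Finset.mul_sum]
  simp only [pow_succ', mul_assoc, add_assoc, add_comm 1, pow_zero, one_mul, add_zero]
  ring

variable {H : Type*} [AddCommGroup H] [Module R H] [Module.Finite R H]

/-- Lift the sequence to a finite free module and solve coordinatewise in `R`. -/
theorem IsAdicComplete.exists_sub_smul_succ (hR : IsAdicComplete (Ideal.span {t}) R) (h : ℕ → H) :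
    ∃ u : ℕ → H, ∀ k, h k = u k - t • u (k + 1) := by
  obtain ⟨n, f, hf⟩ := Module.Finite.exists_fin' R H
  choose r hr using fun k => hf (h k)
  choose U hU using fun j => hR.exists_sub_mul_succ fun k => r k j
  refine ⟨fun k => f fun j => U j k, fun k => ?_⟩
  rw [← map_smul, ← map_sub, ← hr]
  congr 1
  ext j
  exact hU j k

/-- Each `u k` is divisible by all powers of `t`. Completeness puts `t` in the Jacobson radical, so
Krull's intersection theorem makes `H` `t`-adically separated. -/
theorem IsAdicComplete.eq_zero_of_eq_smul_succ [IsNoetherianRing R]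
    (hR : IsAdicComplete (Ideal.span {t}) R) {u : ℕ → H} (hu : ∀ k, u k = t • u (k + 1)) (k : ℕ) :
    u k = 0 := by
  have hH := IsHausdorff.of_le_jacobson (Ideal.span {t}) H (IsAdicComplete.le_jacobson_bot _)
  refine hH.haus _ fun n => ?_
  have : ∀ n, u k = t ^ n • u (k + n) := fun n => by
    induction n with
    | zero => simp
    | succ n ih => rw [ih, hu (k + n), smul_smul, pow_succ, add_assoc]
  rw [SModEq.zero, this n]
  exact Submodule.smul_mem_smul (Ideal.pow_mem_pow (Ideal.mem_span_singleton_self t) n) trivial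

end AdicSequences

/-! ### Restriction and extension of scalars -/

namespace PreDGModule

variable {R : Type u} [CommRing R] {A B : DGAlgebra R}

section Restrict

variable (f : DGAlgebra.Hom A B)

/-- Restriction of scalars along a morphism of DG algebras. -/
def restrict (N : PreDGModule B) : PreDGModule A where
  carrier := N.carrier
  moduleA := Module.compHom N f.toAlgHom.toRingHom
  tower := letI := Module.compHom N f.toAlgHom.toRingHom
    ⟨fun r a n => by
      change f.toAlgHom (r • a) • n = r • f.toAlgHom a • n
      rw [map_smul, smul_assoc]⟩
  gr := N.gr
  smul_mem ha hm := N.smul_mem (f.map_gr ha) hm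
  d := N.d
  d_mem := N.d_mem
  d_d := N.d_d
  leibniz a m := by
    change N.d (f.toAlgHom a • m) = f.toAlgHom (A.d a) • m + f.toAlgHom (A.twist 1 a) • N.d m
    rw [N.leibniz, f.map_d, f.map_twist]

variable {N N' : PreDGModule B}

/-- The identity, from the restriction of scalars of `N` to `N`. -/
def ofRestrict (N : PreDGModule B) : restrict f N →ₗ[R] N := LinearMap.id (M := N)

/-- Restriction of scalars on maps. -/
def restrictMap (g : N →ₗ[R] N') : restrict f N →ₗ[R] restrict f N' := g

variable {f} {p : ℤ} {g h : N →ₗ[R] N'}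

theorem IsTwisted.restrictScalars (hg : IsTwisted p g) : IsTwisted p (restrictMap f g) := fun a m => by
  have := hg (f.toAlgHom a) m
  rw [f.map_twist] at this
  exact this

theorem IsCycle.restrictScalars (hg : IsCycle p g) : IsCycle p (restrictMap f g) :=
  ⟨hg.1, hg.2.restrictScalars, hg.3⟩

theorem IsNull.restrictScalars (hg : IsNull p g) : IsNull p (restrictMap f g) :=
  let ⟨h, hh⟩ := hg; ⟨restrictMap f h, hh.1, hh.2.restrictScalars, hh.3⟩

theorem IsQuasiIso.restrictScalars (hg : IsQuasiIso g) : IsQuasiIso (restrictMap f g) :=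
  ⟨hg.1.restrictScalars, hg.2, hg.3⟩

end Restrict

section BaseChange

open DGModule

variable (f : DGAlgebra.Hom A B) (M : DGModule A)

/-- The bilinear map `(s, m) ↦ s ⊗ m`, with values in the DG module `B ⊗ M`. -/
def tensorMk : B →ₗ[R] M →ₗ[R] (baseChange f M).toPre := bmul f M

variable {f M} in
theorem tensorMk_induction {motive : (baseChange f M).toPre → Prop} (zero : motive 0)
    (add : ∀ x y, motive x → motive y → motive (x + y))
    (tmul : ∀ s m, motive (tensorMk f M s m)) (n) : motive n :=
  baseChange_induction zero add tmul n

variable {f M} in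
theorem tensorMk_gr_induction {i : ℤ} {motive : (baseChange f M).toPre → Prop} (zero : motive 0)
    (add : ∀ x y, motive x → motive y → motive (x + y))
    (tmul : ∀ j k s m, s ∈ B.gr j → m ∈ M.gr k → j + k = i → motive (tensorMk f M s m))
    {n} (hn : n ∈ (baseChange f M).toPre.gr i) : motive n :=
  baseChangeGr_induction (motive := fun n _ => motive n) zero (fun x y _ _ => add x y)
    (fun j k s m hs hm h => tmul j k s m hs hm h) hn

theorem smul_tensorMk (a s : B) (m : M) : a • tensorMk f M s m = tensorMk f M (a * s) m := rfl

theorem tensorMk_smul (s : B) (a : A) (m : M) :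
    tensorMk f M s (a • m) = tensorMk f M (s * f.toAlgHom a) m :=
  bmul_smul f M s a m

theorem tensorMk_mem {i j k : ℤ} {s : B} {m : M} (hs : s ∈ B.gr i) (hm : m ∈ M.gr j)
    (h : i + j = k) : tensorMk f M s m ∈ (baseChange f M).toPre.gr k :=
  DG.mem_totalGr hs hm h

theorem d_tensorMk (s : B) (m : M) : (baseChange f M).toPre.d (tensorMk f M s m) =
    tensorMk f M (B.d s) m + tensorMk f M (B.twist 1 s) (M.d m) := by
  rw [← B.signMap_eq_twist]; exact baseChangeD_bmul' f M s m

/-- The map `m ↦ 1 ⊗ m`. -/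
def unitMap : M.toPre →ₗ[R] restrict f (baseChange f M).toPre := tensorMk f M 1

theorem isCycle_unitMap : IsCycle 0 (unitMap f M) := by
  refine ⟨fun i m hm => ?_, fun a m => ?_, fun m => ?_⟩
  · exact tensorMk_mem f M (SetLike.one_mem_graded B.gr) hm (by ring)
  · rw [A.twist_zero]
    change tensorMk f M 1 (a • m) = f.toAlgHom a • tensorMk f M 1 m
    rw [tensorMk_smul, smul_tensorMk, one_mul, mul_one]
  · rw [Int.negOnePow_zero, one_smul]
    change (baseChange f M).toPre.d (tensorMk f M 1 m) = tensorMk f M 1 (M.d m)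
    rw [d_tensorMk, B.d_zero (SetLike.one_mem_graded B.gr), map_zero, LinearMap.zero_apply,
      zero_add, B.twist_one]

variable {f M} {N : PreDGModule B} {p : ℤ}

/-- The extension of a twisted map to the base change. -/
def extendScalars (p : ℤ) (φ : M.toPre →ₗ[R] restrict f N) (hφ : IsTwisted p φ) :
    (baseChange f M).toPre →ₗ[R] N :=
  baseChangeLift (LinearMap.mk₂ R (fun (s : B) (m : M) => B.twist p s • ofRestrict f N (φ m))
    (fun a b m => by rw [map_add, add_smul])
    (fun c a m => by rw [map_smul, smul_assoc])
    (fun a m n => by rw [map_add, map_add, smul_add])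
    (fun c a m => by rw [map_smul, map_smul, smul_comm])) (fun s a m => by
      rw [LinearMap.mk₂_apply, LinearMap.mk₂_apply, hφ a m, B.twist_mul, mul_smul, f.map_twist]
      rfl)

theorem extendScalars_tensorMk {φ : M.toPre →ₗ[R] restrict f N} (hφ : IsTwisted p φ) (s : B) (m : M) :
    extendScalars p φ hφ (tensorMk f M s m) = B.twist p s • ofRestrict f N (φ m) :=
  baseChangeLift_bmul _ _ _ _ s m

theorem extendScalars_comp_unitMap {φ : M.toPre →ₗ[R] restrict f N} (hφ : IsTwisted p φ) :
    restrictMap f (extendScalars p φ hφ) ∘ₗ unitMap f M = φ := by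
  ext m
  refine (extendScalars_tensorMk hφ 1 m).trans ?_
  rw [B.twist_one]
  exact one_smul _ _

/-- This is the direction of the adjunction between `B ⊗ -` and restriction that is needed: a cycle
over `A` out of `M` becomes a cycle over `B` out of `B ⊗ M`, recovered by composing with `unitMap`.
-/
theorem isCycle_extendScalars {φ : M.toPre →ₗ[R] restrict f N} (hφ : IsCycle p φ) :
    IsCycle p (extendScalars p φ hφ.isTwisted) := by
  have hT : IsTwisted p (extendScalars p φ hφ.isTwisted) := by
    intro a n
    induction n using tensorMk_induction with
    | zero => simp
    | add x y hx hy => rw [smul_add, map_add, hx, hy, map_add, smul_add]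
    | tmul s m =>
      rw [extendScalars_tensorMk, ← mul_smul, ← B.twist_mul, smul_tensorMk, extendScalars_tensorMk]
  refine ⟨fun i n hn => ?_, hT, fun n => ?_⟩
  · refine tensorMk_gr_induction (motive := fun n => extendScalars p φ hφ.isTwisted n ∈ N.gr (i + p))
      (by rw [map_zero]; exact zero_mem _)
      (fun x y hx hy => by rw [map_add]; exact add_mem hx hy) (fun j k s m hs hm h => ?_) hn
    rw [extendScalars_tensorMk]
    have := N.smul_mem (B.twist_mem p hs) (hφ.1 _ _ hm)
    rwa [← add_assoc, h] at this
  · induction n using tensorMk_induction with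
    | zero => simp
    | add x y hx hy => simp only [map_add, hx, hy, smul_add]
    | tmul s m =>
      have e' : N.d (ofRestrict f N (φ m)) = p.negOnePow • ofRestrict f N (φ (M.d m)) := hφ.3 m
      rw [d_tensorMk, map_add, extendScalars_tensorMk, extendScalars_tensorMk, extendScalars_tensorMk,
        N.leibniz, e',
        B.twist_twist, B.twist_twist, B.twist_d, DG.units_smul_smul, smul_add,
        DG.units_smul_units_smul, DG.smul_units_smul, add_comm 1 p]

/-- If `L → B ⊗ M` is a quasi-isomorphism and all cycles `L → B ⊗ M` are boundaries, then so are
all cycles `M → B ⊗ M`. -/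
theorem SemiBasis.isNull_of_quasiIso_baseChange (b : SemiBasis M.toPre) {L : PreDGModule B}
    {ρ : L →ₗ[R] (baseChange f M).toPre} (hρ : IsQuasiIso ρ)
    (h : ∀ φ : L →ₗ[R] (baseChange f M).toPre, IsCycle p φ → IsNull p φ)
    {φ : M.toPre →ₗ[R] restrict f (baseChange f M).toPre} (hφ : IsCycle p φ) : IsNull p φ := by
  -- Over `A` the unit `M → B ⊗ M` is homotopic to `ρ ∘ s`. Hence `φ`, which is its extension
  -- composed with the unit, is homotopic to the extension composed with `ρ ∘ s`, and the extension
  -- composed with `ρ` is null by assumption.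
  obtain ⟨s, hs, hn⟩ := b.exists_lift_cycle (hρ.restrictScalars (f := f)) (isCycle_unitMap f M)
  have h1 := (h _ (by simpa using (isCycle_extendScalars hφ).comp hρ.isCycle)).restrictScalars (f := f)
    |>.comp hs
  have h2 := hn.postcomp ((isCycle_extendScalars hφ).restrictScalars (f := f))
  rw [add_zero, LinearMap.comp_sub, extendScalars_comp_unitMap] at h2
  exact h2.of_sub h1

end BaseChange

/-! ### Countable powers and a Nakayama lemma for Hom complexes -/

section Powers

/-- The product of countably many copies of `N`. -/
def pow (N : PreDGModule A) : PreDGModule A where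
  carrier := ℕ → N
  gr i := Submodule.pi Set.univ fun _ => N.gr i
  smul_mem ha hm := fun k _ => N.smul_mem ha (hm k trivial)
  d := N.d.compLeft ℕ
  d_mem hm := fun k _ => N.d_mem (hm k trivial)
  d_d _ := funext fun _ => N.d_d _
  leibniz a _ := funext fun _ => N.leibniz a _

/-- The map `(u k) ↦ (u k - t • u (k + 1))`. -/
def subShift (t : R) (N : PreDGModule A) : N.pow →ₗ[R] N.pow :=
  LinearMap.pi fun k : ℕ => (LinearMap.proj k - t • LinearMap.proj (k + 1) : (ℕ → N) →ₗ[R] N)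

theorem isCycle_subShift (t : R) (N : PreDGModule A) : IsCycle 0 (subShift t N) := by
  refine ⟨fun i u hu k _ => ?_, fun a u => funext fun k => ?_, fun u => funext fun k => ?_⟩
  · rw [add_zero]
    exact sub_mem (hu k trivial) (Submodule.smul_mem _ _ (hu (k + 1) trivial))
  · rw [A.twist_zero]
    change a • u k - t • a • u (k + 1) = a • (u k - t • u (k + 1))
    rw [smul_sub, smul_comm]
  · rw [Int.negOnePow_zero, one_smul]
    change N.d (u k - t • u (k + 1)) = N.d (u k) - t • N.d (u (k + 1))
    rw [map_sub, map_smul]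

/-- The cycles of degree `i` as an `R`-module. -/
def cyclesR (N : PreDGModule A) (i : ℤ) : Submodule R N := N.gr i ⊓ LinearMap.ker N.d

/-- The boundaries of degree `i` as an `R`-module. -/
def boundariesR (N : PreDGModule A) (i : ℤ) : Submodule R N := (N.gr (i + 1)).map N.d

/-- The homology in degree `i` as an `R`-module. -/
abbrev homologyR (N : PreDGModule A) (i : ℤ) : Type u :=
  N.cyclesR i ⧸ (N.boundariesR i).submoduleOf (N.cyclesR i)

/-- Homology commutes with products, so the induced map is `(u k) ↦ (u k - t • u (k + 1))` on
sequences in a finite `R`-module. Separatedness gives injectivity, convergence gives surjectivity.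
-/
theorem isQuasiIso_subShift [IsNoetherianRing R] {t : R} (hR : IsAdicComplete (Ideal.span {t}) R)
    (N : PreDGModule A) (hN : ∀ i, Module.Finite R (N.homologyR i)) :
    IsQuasiIso (subShift t N) := by
  refine ⟨isCycle_subShift t N, fun {i} (z y : ℕ → N) hz hdz hy h => ?_,
    fun {i} (y : ℕ → N) hy hdy => ?_⟩
  · have hc : ∀ k, z k ∈ N.cyclesR i := fun k => ⟨hz k trivial, congr_fun hdz k⟩
    have hk := hR.eq_zero_of_eq_smul_succ
      (u := fun k => (Submodule.Quotient.mk ⟨z k, hc k⟩ : N.homologyR i)) (fun k => by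
        rw [← Submodule.Quotient.mk_smul, Submodule.Quotient.eq]
        exact ⟨y k, hy k trivial, congr_fun h k⟩)
    choose w hw hdw using fun k => (Submodule.Quotient.mk_eq_zero _).1 (hk k)
    exact ⟨w, fun k _ => hw k, funext hdw⟩
  · have hc : ∀ k, y k ∈ N.cyclesR i := fun k => ⟨hy k trivial, congr_fun hdy k⟩
    obtain ⟨u, hu⟩ := hR.exists_sub_smul_succ
      fun k => (Submodule.Quotient.mk ⟨y k, hc k⟩ : N.homologyR i)
    choose c hc' using fun k => Submodule.Quotient.mk_surjective _ (u k)
    simp only [← hc', ← Submodule.Quotient.mk_smul, ← Submodule.Quotient.mk_sub] at hu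
    choose v hv hdv using fun k => (Submodule.Quotient.eq _).1 (hu k)
    refine ⟨fun k => c k, fun k _ => (c k).2.1, funext fun k => (c k).2.2, v, fun k _ => hv k,
      funext fun k => ?_⟩
    have : N.d (v k) = y k - ((c k : N) - t • (c (k + 1) : N)) := hdv k
    change y k = (c k : N) - t • (c (k + 1) : N) + N.d (v k)
    rw [this]
    abel

/-- A form of Nakayama's lemma for the homology of the complex of homomorphisms. -/
theorem SemiBasis.isNull_of_forall_isNull_sub_smul [IsNoetherianRing R] {t : R}
    (hR : IsAdicComplete (Ideal.span {t}) R) {M N : PreDGModule A} (b : SemiBasis M)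
    (hN : ∀ i, Module.Finite R (N.homologyR i)) {p : ℤ}
    (h : ∀ z : M →ₗ[R] N, IsCycle p z → ∃ w, IsCycle p w ∧ IsNull p (z - t • w))
    {z : M →ₗ[R] N} (hz : IsCycle p z) : IsNull p z := by
  choose! w hw hn using h
  -- Repeated division of `z` by `t` up to homotopy.
  let s : ℕ → (M →ₗ[R] N) := fun k => w^[k] z
  have hs : ∀ k, IsCycle p (s k) := fun k => by
    induction k with
    | zero => exact hz
    | succ k ih =>
      change IsCycle p (w^[k + 1] z)
      rw [Function.iterate_succ_apply']
      exact hw _ ih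
  have hn' : ∀ k, IsNull p (s k - t • s (k + 1)) := fun k => by
    change IsNull p (w^[k] z - t • w^[k + 1] z)
    rw [Function.iterate_succ_apply']
    exact hn _ (hs k)
  choose y hy using hn'
  let φ : M →ₗ[R] N.pow := LinearMap.pi (φ := fun _ : ℕ => N) s
  let η : M →ₗ[R] N.pow := LinearMap.pi (φ := fun _ : ℕ => N) y
  have hφ : IsCycle p φ := ⟨fun i m hm k _ => (hs k).1 i m hm,
    fun a m => funext fun k => (hs k).2 a m, fun m => funext fun k => (hs k).3 m⟩
  have hη : IsHomotopy p η (subShift t N ∘ₗ φ) := ⟨fun i m hm k _ => (hy k).1 i m hm,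
    fun a m => funext fun k => (hy k).2 a m, fun m => funext fun k => (hy k).3 m⟩
  -- The homotopies `y k` together bound `subShift t N ∘ₗ φ`. Cancelling the quasi-isomorphism
  -- bounds `φ`, and component `0` of the resulting homotopy bounds `z`.
  obtain ⟨ψ, hψ, -⟩ := b.exists_lift (isQuasiIso_subShift hR N hN) hφ hη
  let ev : N.pow →ₗ[R] N := LinearMap.proj (φ := fun _ : ℕ => N) 0
  exact ⟨ev ∘ₗ ψ, fun i m hm => hψ.1 i m hm 0 trivial, fun a m => congr_fun (hψ.2 a m) 0,
    fun m => congr_fun (hψ.3 m) 0⟩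

end Powers

end PreDGModule

/-! ### Coordinates on the Koszul extension -/

namespace DGAlgebra

variable {R : Type u} [CommRing R] (t : R) (A : DGAlgebra R)

/-- The coefficient of `1`. -/
def koszulFst : koszul t →ₗ[R] R := (TrivSqZeroExt.fstHom R R R).toLinearMap

/-- The coefficient of `e`. -/
def koszulSnd : koszul t →ₗ[R] R := TrivSqZeroExt.sndHom R R

theorem koszulFst_one : koszulFst t 1 = 1 := TrivSqZeroExt.fst_one (R := R) (M := R)

theorem koszulSnd_one : koszulSnd t 1 = 0 := TrivSqZeroExt.snd_one (R := R) (M := R)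

theorem koszulFst_d (x : koszul t) : koszulFst t ((koszul t).d x) = t * koszulSnd t x :=
  TrivSqZeroExt.fst_inl R _

theorem koszulSnd_d (x : koszul t) : koszulSnd t ((koszul t).d x) = 0 :=
  TrivSqZeroExt.snd_inl R (t * koszulSnd t x)

theorem koszulFst_eq_zero {i : ℤ} {x : koszul t} (hx : x ∈ (koszul t).gr i) (hi : i ≠ 0) :
    koszulFst t x = 0 := hx.1 hi

theorem koszulSnd_eq_zero {i : ℤ} {x : koszul t} (hx : x ∈ (koszul t).gr i) (hi : i ≠ 1) :
    koszulSnd t x = 0 := hx.2 hi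

variable (K : DGAlgebra R)

/-- The bilinear map `(x, a) ↦ x ⊗ a`, with values in the DG algebra `K ⊗ A`. -/
def tensorOf : K →ₗ[R] A →ₗ[R] K.tensor A := tmul K A

variable {K A}

theorem tensorOf_induction {motive : K.tensor A → Prop} (zero : motive 0)
    (add : ∀ x y, motive x → motive y → motive (x + y))
    (tmul : ∀ x a, motive (tensorOf A K x a)) (s) : motive s :=
  tensor_induction zero add (fun _ _ x a _ _ => tmul x a) s

theorem tensorOf_gr_induction {i : ℤ} {motive : K.tensor A → Prop} (zero : motive 0)
    (add : ∀ x y, motive x → motive y → motive (x + y))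
    (tmul : ∀ j k x a, x ∈ K.gr j → a ∈ A.gr k → j + k = i → motive (tensorOf A K x a))
    {s} (hs : s ∈ (K.tensor A).gr i) : motive s :=
  tensorGr_induction (motive := fun n _ => motive n) zero (fun x y _ _ => add x y)
    (fun j k x a hx ha h => tmul j k x a hx ha h) hs

theorem tensorOf_mul_tensorRight (x : K) (a a' : A) :
    tensorOf A K x a * (tensorRight K A).toAlgHom a' = tensorOf A K x (a * a') := by
  change tmul K A x a * tmul K A 1 a' = tmul K A x (a * a')
  induction a using DirectSum.Decomposition.inductionOn A.gr with
  | zero => simp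
  | add y z hy hz => rw [map_add, add_mul, hy, hz, add_mul, map_add]
  | homogeneous a =>
    rw [tmul_mul_tmul x a.2 (SetLike.one_mem_graded K.gr)]
    simp

/-- The Koszul sign for moving `a` past `x`. It is the reason why the projection onto the
coefficient of `e` is `A`-linear only up to a twist. -/
theorem tensorRight_mul_tensorOf {x : K} {i : ℤ} (hx : x ∈ K.gr i) (a : A) :
    (tensorRight K A).toAlgHom a * tensorOf A K x 1 =
      tensorOf A K x 1 * (tensorRight K A).toAlgHom (A.twist i a) := by
  rw [tensorOf_mul_tensorRight, one_mul]
  change tmul K A 1 a * tmul K A x 1 = tmul K A x _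
  induction a using DirectSum.Decomposition.inductionOn A.gr with
  | zero => simp
  | add y z hy hz => rw [map_add, add_mul, hy, hz, map_add, map_add]
  | homogeneous a =>
    rw [tmul_mul_tmul 1 a.2 hx, A.twist_apply i a.2, DG.map_units_smul, mul_comm i]
    simp

theorem d_tensorOf_one {x : K} : (K.tensor A).d (tensorOf A K x 1) = tensorOf A K (K.d x) 1 := by
  change tensorD K A (tmul K A x 1) = tmul K A (K.d x) 1
  induction x using DirectSum.Decomposition.inductionOn K.gr with
  | zero => simp
  | add y z hy hz => simp only [map_add, LinearMap.add_apply, hy, hz]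
  | homogeneous x =>
    rw [tensorD_tmul x.2, A.d_zero (SetLike.one_mem_graded A.gr)]
    simp

theorem tensorOf_mem {i j k : ℤ} {x : K} {a : A} (hx : x ∈ K.gr i) (ha : a ∈ A.gr j)
    (h : i + j = k) : tensorOf A K x a ∈ (K.tensor A).gr k :=
  DG.mem_totalGr hx ha h

/-- The projection `K ⊗ A → A` induced by a linear form on `K`. -/
def tensorProj (κ : K →ₗ[R] R) : K.tensor A →ₗ[R] A :=
  tensorLift K A ((LinearMap.lsmul R A : R →ₗ[R] A →ₗ[R] A) ∘ₗ κ)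

theorem tensorProj_tensorOf (κ : K →ₗ[R] R) (x : K) (a : A) :
    tensorProj κ (tensorOf A K x a) = κ x • a := tensorLift_tmul _ _ _ _ _

theorem tensorProj_mul (κ : K →ₗ[R] R) (s : K.tensor A) (a : A) :
    tensorProj κ (s * (tensorRight K A).toAlgHom a) = tensorProj κ s * a := by
  induction s using tensorOf_induction with
  | zero => simp
  | add x y hx hy => rw [add_mul, map_add, hx, hy, map_add, add_mul]
  | tmul x a' =>
    rw [tensorOf_mul_tensorRight, tensorProj_tensorOf, tensorProj_tensorOf, smul_mul_assoc]

theorem tensorProj_mem {κ : K →ₗ[R] R} {j : ℤ} (hκ : ∀ i, ∀ x ∈ K.gr i, i ≠ j → κ x = 0) {i : ℤ}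
    {s : K.tensor A} (hs : s ∈ (K.tensor A).gr i) : tensorProj κ s ∈ A.gr (i - j) := by
  refine tensorOf_gr_induction (motive := fun s => tensorProj κ s ∈ A.gr (i - j))
    (by rw [map_zero]; exact zero_mem _)
    (fun x y hx hy => by rw [map_add]; exact add_mem hx hy) (fun k l x a hx ha h => ?_) hs
  rw [tensorProj_tensorOf]
  by_cases hk : k = j
  · exact Submodule.smul_mem _ _ (by rwa [show i - j = l by omega])
  · rw [hκ k x hx hk, zero_smul]; exact zero_mem _

end DGAlgebra

namespace PreDGModule

open DGModule DGAlgebra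

variable {R : Type u} [CommRing R] {A K : DGAlgebra R} (M : DGModule A)

/-- The map `m ↦ x ⊗ m` to `(K ⊗ A) ⊗ M`. -/
def koszulMk (x : K) : M →ₗ[R] (baseChange (tensorRight K A) M).toPre :=
  tensorMk (tensorRight K A) M (tensorOf A K x 1)

/-- The projection `(K ⊗ A) ⊗ M → M` induced by a linear form on `K`. -/
def baseChangeProj (κ : K →ₗ[R] R) : (baseChange (tensorRight K A) M).toPre →ₗ[R] M :=
  baseChangeLift (LinearMap.mk₂ R (fun (s : K.tensor A) (m : M) => tensorProj κ s • m)
    (fun a b m => by rw [map_add, add_smul])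
    (fun c a m => by rw [map_smul, smul_assoc])
    (fun a m n => smul_add _ _ _)
    (fun c a m => smul_comm _ _ _)) (fun s a m => by
      rw [LinearMap.mk₂_apply, LinearMap.mk₂_apply, tensorProj_mul, mul_smul])

theorem baseChangeProj_tensorMk (κ : K →ₗ[R] R) (s : K.tensor A) (m : M) :
    baseChangeProj M κ (tensorMk (tensorRight K A) M s m) = tensorProj κ s • m :=
  baseChangeLift_bmul _ _ _ _ _ _

variable {M}

theorem baseChangeProj_koszulMk (κ : K →ₗ[R] R) (x : K) (m : M) :
    baseChangeProj M κ (koszulMk M x m) = κ x • m := by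
  rw [koszulMk, baseChangeProj_tensorMk, tensorProj_tensorOf, smul_assoc, one_smul]

theorem baseChangeProj_mem {κ : K →ₗ[R] R} {j : ℤ} (hκ : ∀ i, ∀ x ∈ K.gr i, i ≠ j → κ x = 0)
    {i : ℤ} {n} (hn : n ∈ (baseChange (tensorRight K A) M).toPre.gr i) :
    baseChangeProj M κ n ∈ M.gr (i - j) := by
  refine tensorMk_gr_induction (motive := fun n => baseChangeProj M κ n ∈ M.gr (i - j))
    (by rw [map_zero]; exact zero_mem _)
    (fun x y hx hy => by rw [map_add]; exact add_mem hx hy) (fun k l s m hs hm h => ?_) hn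
  rw [baseChangeProj_tensorMk]
  have := M.smul_mem (tensorProj_mem hκ hs) hm
  rwa [show k - j + l = i - j by omega] at this

/-- Since `(x ⊗ a) ⊗ m = (x ⊗ 1) ⊗ a m`, the module `(K ⊗ A) ⊗ M` is spanned by the image of `K ⊗
M`; identities need only be checked there. -/
theorem koszulMk_induction {motive : (baseChange (tensorRight K A) M).toPre → Prop}
    (zero : motive 0) (add : ∀ x y, motive x → motive y → motive (x + y))
    (mk : ∀ i (x : K), x ∈ K.gr i → ∀ m, motive (koszulMk M x m)) (n) : motive n := by
  induction n using tensorMk_induction with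
  | zero => exact zero
  | add x y hx hy => exact add x y hx hy
  | tmul s m =>
    induction s using tensorOf_induction with
    | zero => rw [map_zero]; exact zero
    | add x y hx hy => rw [map_add]; exact add _ _ hx hy
    | tmul x a =>
      induction x using DirectSum.Decomposition.inductionOn K.gr with
      | zero => rw [map_zero, LinearMap.zero_apply, map_zero]; exact zero
      | add x y hx hy => simp only [map_add, LinearMap.add_apply]; exact add _ _ hx hy
      | homogeneous x =>
        have := mk _ x.1 x.2 (a • m)
        rwa [koszulMk, tensorMk_smul, tensorOf_mul_tensorRight, one_mul] at this

theorem smul_koszulMk {i : ℤ} {x : K} (hx : x ∈ K.gr i) (a : A) (m : M) :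
    (tensorRight K A).toAlgHom a • koszulMk M x m = koszulMk M x (A.twist i a • m) := by
  rw [koszulMk, smul_tensorMk, tensorRight_mul_tensorOf hx, tensorMk_smul]

theorem d_koszulMk {i : ℤ} {x : K} (hx : x ∈ K.gr i) (m : M) :
    (baseChange (tensorRight K A) M).toPre.d (koszulMk M x m) =
      koszulMk M (K.d x) m + i.negOnePow • koszulMk M x (M.d m) := by
  rw [koszulMk, d_tensorMk, d_tensorOf_one, DGAlgebra.twist_apply _ 1
    (tensorOf_mem hx (SetLike.one_mem_graded A.gr) (add_zero i)), DG.map_units_smul₂, one_mul]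
  rfl

theorem baseChangeProj_smul {κ : K →ₗ[R] R} {j : ℤ} (hκ : ∀ i, ∀ x ∈ K.gr i, i ≠ j → κ x = 0)
    (a : A) (n : (baseChange (tensorRight K A) M).toPre) :
    baseChangeProj M κ ((tensorRight K A).toAlgHom a • n) = A.twist j a • baseChangeProj M κ n := by
  induction n using koszulMk_induction with
  | zero => rw [smul_zero, map_zero, smul_zero]
  | add x y hx hy => rw [smul_add, map_add, hx, hy, map_add, smul_add]
  | mk i x hx m =>
    rw [smul_koszulMk hx, baseChangeProj_koszulMk, baseChangeProj_koszulMk]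
    by_cases h : i = j
    · rw [h, smul_comm]
    · rw [hκ i x hx h, zero_smul, zero_smul, smul_zero]

section Koszul

variable {t : R}

/-- With `n = 1 ⊗ m₀ + e ⊗ m₁` one has `d n = 1 ⊗ (d m₀ + t m₁) - e ⊗ d m₁`, the differential of the
mapping cone of `t`. This lemma and the next read off the two coefficients. -/
theorem baseChangeProj_snd_d (n : (baseChange (tensorRight (koszul t) A) M).toPre) :
    baseChangeProj M (koszulSnd t) ((baseChange (tensorRight (koszul t) A) M).toPre.d n) =
      -M.d (baseChangeProj M (koszulSnd t) n) := by
  induction n using koszulMk_induction with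
  | zero => simp only [map_zero, neg_zero]
  | add x y hx hy => simp only [map_add, hx, hy, neg_add]
  | mk i x hx m =>
    rw [d_koszulMk hx, map_add, DG.map_units_smul, baseChangeProj_koszulMk,
      baseChangeProj_koszulMk, baseChangeProj_koszulMk, koszulSnd_d, zero_smul, zero_add, map_smul]
    by_cases h : i = 1
    · rw [h, Int.negOnePow_one, Units.neg_smul, one_smul]
    · rw [koszulSnd_eq_zero t hx h, zero_smul, smul_zero, neg_zero]

theorem baseChangeProj_fst_d (n : (baseChange (tensorRight (koszul t) A) M).toPre) :
    baseChangeProj M (koszulFst t) ((baseChange (tensorRight (koszul t) A) M).toPre.d n) =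
      M.d (baseChangeProj M (koszulFst t) n) + t • baseChangeProj M (koszulSnd t) n := by
  induction n using koszulMk_induction with
  | zero => simp only [map_zero, smul_zero, add_zero]
  | add x y hx hy => simp only [map_add, hx, hy, smul_add]; abel
  | mk i x hx m =>
    rw [d_koszulMk hx, map_add, DG.map_units_smul, baseChangeProj_koszulMk,
      baseChangeProj_koszulMk, baseChangeProj_koszulMk, baseChangeProj_koszulMk, koszulFst_d,
      mul_smul, map_smul, add_comm]
    by_cases h : i = 0
    · rw [h, Int.negOnePow_zero, one_smul]
    · rw [koszulFst_eq_zero t hx h, zero_smul, smul_zero]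

/-- If `1 ⊗ z` is a boundary for a cycle `z : M → M`, then `z` is a multiple of `t` in homology. -/
theorem exists_isNull_sub_smul {L : PreDGModule A} {p : ℤ} {z : L →ₗ[R] M.toPre}
    (h : IsNull p (unitMap (tensorRight (koszul t) A) M ∘ₗ z)) :
    ∃ w, IsCycle p w ∧ IsNull p (z - t • w) := by
  obtain ⟨h, hh⟩ := h
  let π₀ : restrict (tensorRight (koszul t) A) (baseChange (tensorRight (koszul t) A) M).toPre →ₗ[R]
    M.toPre := baseChangeProj M (koszulFst t)
  let π₁ : restrict (tensorRight (koszul t) A) (baseChange (tensorRight (koszul t) A) M).toPre →ₗ[R]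
    M.toPre := baseChangeProj M (koszulSnd t)
  have h0 : ∀ m, π₀ (unitMap (tensorRight (koszul t) A) M m) = m := fun m => by
    refine (baseChangeProj_koszulMk (koszulFst t) (1 : koszul t) m).trans ?_
    rw [koszulFst_one, one_smul]
  have h1 : ∀ m, π₁ (unitMap (tensorRight (koszul t) A) M m) = 0 := fun m => by
    refine (baseChangeProj_koszulMk (koszulSnd t) (1 : koszul t) m).trans ?_
    rw [koszulSnd_one, zero_smul]
  have d0 : ∀ n, π₀ ((restrict _ _).d n) = M.d (π₀ n) + t • π₁ n := baseChangeProj_fst_d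
  have d1 : ∀ n, π₁ ((restrict _ _).d n) = -M.d (π₁ n) := baseChangeProj_snd_d
  have t0 : IsTwisted 0 π₀ := baseChangeProj_smul fun i x hx hi => koszulFst_eq_zero t hx hi
  have t1 : IsTwisted (-1) π₁ := fun a n => by
    rw [A.twist_congr (show Even ((-1 : ℤ) - 1) from ⟨-1, by ring⟩)]
    exact baseChangeProj_smul (fun i x hx hi => koszulSnd_eq_zero t hx hi) a n
  have g0 : HasDegree 0 π₀ := fun i m hm => by
    have := baseChangeProj_mem (fun i x hx hi => koszulFst_eq_zero t hx hi) hm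
    rwa [sub_zero, ← add_zero i] at this
  have g1 : HasDegree (-1) π₁ := fun i m hm =>
    baseChangeProj_mem (fun i x hx hi => koszulSnd_eq_zero t hx hi) hm
  -- The coefficient of `e` in `1 ⊗ z` is zero, so the homotopy identity says that the `e`-part of
  -- `h` is a cycle; it has degree `p + 1 - 1 = p`.
  have e1 : ∀ m, M.d (π₁ (h m)) = p.negOnePow • π₁ (h (L.d m)) := fun m => by
    have := congrArg π₁ (hh.3 m)
    rw [LinearMap.comp_apply, h1, map_add, d1, DG.map_units_smul] at this
    rw [eq_comm, neg_add_eq_zero] at this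
    exact this
  refine ⟨π₁ ∘ₗ h, ⟨?_, ?_, e1⟩, π₀ ∘ₗ h, ?_, ?_, fun m => ?_⟩
  · simpa using g1.comp hh.1
  · simpa using t1.comp hh.2
  · simpa using g0.comp hh.1
  · simpa using t0.comp hh.2
  -- The coefficient of `1` in the same identity reads `z = t • (π₁ ∘ h)` plus the boundary of `π₀ ∘
  -- h`.
  · have := congrArg π₀ (hh.3 m)
    rw [LinearMap.comp_apply, h0, map_add, d0, DG.map_units_smul] at this
    simp only [LinearMap.sub_apply, LinearMap.smul_apply, LinearMap.comp_apply]
    rw [this]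
    abel

end Koszul

end PreDGModule

/-! ### Finiteness of homology over the base ring -/

namespace DGModule

variable {R : Type u} [CommRing R] {A : DGAlgebra R}

/-- The class of a cycle in homology. -/
def homologyMk (M : DGModule A) (i : ℤ) (z : M.cycles i) : M.homology i := Submodule.Quotient.mk z

theorem homologyMk_surjective (M : DGModule A) (i : ℤ) : Function.Surjective (M.homologyMk i) :=
  Submodule.Quotient.mk_surjective _

theorem homologyMk_eq {M : DGModule A} {i : ℤ} {z z' : M.cycles i} :
    M.homologyMk i z = M.homologyMk i z' ↔ (z : M) - z' ∈ M.boundaries i :=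
  Submodule.Quotient.eq _

theorem homologyMk_add (M : DGModule A) (i : ℤ) (z z' : M.cycles i) :
    M.homologyMk i (z + z') = M.homologyMk i z + M.homologyMk i z' := rfl

theorem homologyMk_smul (M : DGModule A) (i : ℤ) (a : A.zero) (z : M.cycles i) :
    M.homologyMk i (a • z) = Ideal.Quotient.mk A.boundaryIdeal a • M.homologyMk i z := rfl

/-- Finite over `H₀(A)` implies finite over `R`, because `A₀` is finite over `R`. The argument runs
on representing cycles, since the two homology modules are quotients of different types. -/
theorem finite_homologyR {M : DGModule A} (hA : Module.Finite R (A.gr 0))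
    (hM : M.HomologicallyDegreewiseFinite) (i : ℤ) : Module.Finite R (M.toPre.homologyR i) := by
  classical
  obtain ⟨s, hs⟩ := (hM i).fg_top
  choose c hc using M.homologyMk_surjective i
  let f : M.homology i → A →ₗ[R] M := fun x =>
    (LinearMap.toSpanSingleton A M (c x : M)).restrictScalars R
  -- The `A₀`-span of cycles representing the generators, finitely generated over `R`; its classes
  -- exhaust the homology.
  let W : Submodule R M := ⨆ x ∈ s, (A.gr 0).map (f x)
  have hW : W.FG := Submodule.fg_biSup s _ fun x _ => (Module.Finite.iff_fg.1 hA).map _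
  have hmem : ∀ x ∈ s, ∀ a ∈ A.gr 0, a • (c x : M) ∈ W := fun x hx a ha =>
    Submodule.mem_iSup_of_mem x (Submodule.mem_iSup_of_mem hx ⟨a, ha, rfl⟩)
  have hWsmul : ∀ a ∈ A.gr 0, ∀ w ∈ W, a • w ∈ W := by
    intro a ha w hw
    have : W ≤ W.comap ((Algebra.lsmul R R M a : M →ₗ[R] M)) := by
      refine iSup₂_le fun x hx => ?_
      rintro _ ⟨a', ha', rfl⟩
      change a • a' • (c x : M) ∈ W
      rw [smul_smul]
      exact hmem x hx _ (by simpa using SetLike.mul_mem_graded ha ha')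
    exact this hw
  have hWle : W ≤ M.toPre.cyclesR i := by
    refine iSup₂_le fun x hx => ?_
    rintro _ ⟨a, ha, rfl⟩
    have := (M.cycles i).smul_mem ⟨a, ha⟩ (c x).2
    exact this
  have key : ∀ x : M.homology i, ∀ z, M.homologyMk i z = x →
      ∃ w ∈ W, (z : M) - w ∈ M.boundaries i := by
    intro x
    have hx : x ∈ Submodule.span A.H0 (s : Set (M.homology i)) := by rw [hs]; trivial
    induction hx using Submodule.span_induction with
    | mem x hx =>
      intro z e
      exact ⟨c x, by simpa using hmem x hx 1 (SetLike.one_mem_graded A.gr),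
        homologyMk_eq.1 (e.trans (hc x).symm)⟩
    | zero =>
      intro z e
      exact ⟨0, zero_mem _, (homologyMk_eq (z' := 0)).1 e⟩
    | add x y _ _ hx hy =>
      intro z e
      obtain ⟨w, hw, b⟩ := hx _ (hc x)
      obtain ⟨w', hw', b'⟩ := hy _ (hc y)
      rw [← hc x, ← hc y, ← homologyMk_add, homologyMk_eq] at e
      refine ⟨w + w', add_mem hw hw', ?_⟩
      convert add_mem e (add_mem b b') using 1
      rw [Submodule.coe_add]
      abel
    | smul r x _ hx =>
      intro z e
      obtain ⟨a, rfl⟩ := Ideal.Quotient.mk_surjective r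
      obtain ⟨w, hw, b⟩ := hx _ (hc x)
      rw [← hc x, ← homologyMk_smul, homologyMk_eq] at e
      refine ⟨(a : A) • w, hWsmul a a.2 w hw, ?_⟩
      convert add_mem e ((M.boundaries i).smul_mem a b) using 1
      rw [smul_sub, Submodule.coe_smul, sub_add_sub_cancel]
      rfl
  have := Module.Finite.iff_fg.2 hW
  refine Module.Finite.of_surjective
    (((M.toPre.boundariesR i).submoduleOf (M.toPre.cyclesR i)).mkQ ∘ₗ Submodule.inclusion hWle)
    fun x => ?_
  obtain ⟨⟨z, hz⟩, rfl⟩ := Submodule.mkQ_surjective _ x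
  obtain ⟨w, hw, b, hb, e⟩ := key _ ⟨z, hz⟩ rfl
  refine ⟨⟨w, hw⟩, ((Submodule.Quotient.eq _).2 ?_).symm⟩
  exact ⟨b, hb, e⟩

end DGModule

end

/-! ### The main theorem -/

theorem mainTheorem5 {R : Type u} [CommRing R] [IsNoetherianRing R]
    (A : DGAlgebra R) (hA : ∀ i, Module.Free R (A.gr i) ∧ Module.Finite R (A.gr i))
    (t : R) (hR : IsAdicComplete (Ideal.span {t}) R)
    (D : DGModule ((DGAlgebra.koszul t).tensor A))
    (hDb : D.HomologicallyBoundedBelow) (hDf : D.HomologicallyDegreewiseFinite)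
    (d : ℤ) (P : DGModule.SemifreeResolution D) (hExt : Subsingleton (P.Ext D d))
    (M : DGModule A) (hM : DGModule.IsQuasiLifting (DGAlgebra.tensorRight (DGAlgebra.koszul t) A) M D)
    (hMf : M.HomologicallyDegreewiseFinite)
    (Q : DGModule.SemifreeResolution M) :
    Subsingleton (Q.Ext M d) := by
  obtain ⟨bP⟩ := P.isSemifree.nonempty_semiBasis
  obtain ⟨bM⟩ := hM.1.nonempty_semiBasis
  obtain ⟨bQ⟩ := Q.isSemifree.nonempty_semiBasis
  -- The resolution map and the Ext hypothesis are the data at the `D` end of the zigzag; they are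
  -- transported to `B ⊗ M`.
  obtain ⟨⟨ρ, hρ⟩, hN⟩ := (bP.exists_quasiIso_of_quasiIsomorphic (-d) hM.2).1
    ⟨⟨_, P.isQuasiIso.toPre⟩, DGModule.subsingleton_homHomology_iff.1 hExt⟩
  -- As `M` is semi-free, it may replace its resolution `Q`, leaving cycles `z : M → M`.
  refine DGModule.subsingleton_homHomology_iff.2 fun φ hφ =>
    bQ.isNull_of_forall_isNull bM Q.isQuasiIso.toPre (fun z hz => ?_) hφ
  refine bM.isNull_of_forall_isNull_sub_smul hR
    (DGModule.finite_homologyR (hA 0).2 hMf) (fun z hz => ?_) hz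
  exact PreDGModule.exists_isNull_sub_smul (t := t) (bM.isNull_of_quasiIso_baseChange hρ hN
    (by simpa using (PreDGModule.isCycle_unitMap _ M).comp hz))
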